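/- Let $K$ be a totally real number field of degree $d$ with ring of integers $\mathcal O$ and discriminant $d_K$, let $N$ and $\mathrm{Tr}$ be the norm and trace from $K$ to $\mathbb Q$, and for an embedding $\nu:K\to\mathbb R$ write $a^{(\nu)}$ for the image of $a$, $|a|_\nu=|a^{(\nu)}|$. Call $a\in K$ totally positive if $a^{(\nu)}>0$ for all $\nu$. **Constants.** * $\sigma_n = 4^d\,\omega_n^{-2d/n}\,|d_K|$, with $\omega_n=\pi^{n/2}/\Gamma(\frac n2+1)$; for $m\ge1$, $\alpha(m)=\sigma_{m+1}\prod_{k=2}^{m+1}\sigma_k^{1/(k-1)}$ and $\mathfrak d(m)=D_1|d_K|^{1+\Sigma(m)}e^{\frac d2(\ln m)^2}$, where $\Sigma(m)=1+\frac12+\dots+\frac1m$ and $D_1$ is a constant such that $\alpha(m)\le\mathfrak d(m)$ and $\mathfrak d(m)\ge1$ for all $m\ge 1$. * $\lambda = C\cdot\big(\max_{y\in\mathcal Y}\max_{\nu,\mu}|y|_\nu/|y|_\mu\big)^2$. Here, for $d\ge2$, $C=\max_\mu\max_{\nu\ne\mu}\frac{|\epsilon_\mu|_\mu^2-1}{1-|\epsilon_\mu|_\nu^2}$,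 where each $\epsilon_\mu\in\mathcal O^\times$ satisfies $|\epsilon_\mu|_\mu>1$ and $|\epsilon_\mu|_\nu<1$ for $\nu\neq\mu$ (for $K=\mathbb Q$ put $C=1$); and $\mathcal Y$ is a finite set of nonzero elements of $\mathcal O$ such that for every totally positive $h\in\mathcal O$ some $y_0\in\mathcal O\setminus\{0\}$ minimizing $\mathrm{Tr}(hy^2)$ over $y\in\mathcal O\setminus\{0\}$ is an associate of an element of $\mathcal Y$. * $\beta=\inf\{r>0:\ \forall(\alpha_\nu)\in\mathbb R^d\ \exists a\in\mathcal O\ \forall\nu\ |\alpha_\nu-a^{(\nu)}|<r\}$; $c(m)$ is the coefficient of $x^m$ in the Maclaurin series of $\exp\!\big(\frac{\beta x}{1-x}\big)$; an element $a\in K$ lies in $\mathcal E(m)$ if $|a|_\nu\le c(m)$ for all $\nu$. **Reduced forms.** A quadratic form $Q$ in $n$ variables over $K$, identified with its symmetric Gram matrix, is positive definite if all its conjugates $Q^{(\nu)}$ are. Such a $Q$ has a unique Lagrange expansion $Q(x)=\sum_{i}h_i\big(x_i+\sum_{j>i}u_{ij}x_j\big)^2$, i.e. $Q=U^tHU$ with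 $H=\mathrm{diag}(h_1,\dots,h_n)$ and $U=(u_{ij})$ upper triangular unipotent; the $h_i$ are its outer and the $u_{ij}$ $(i<j)$ its inner coefficients. For the inverse form $Q^{-1}=U^{-1}H^{-1}(U^{-1})^t$ the $(i,j)$ inner coefficient $(i<j)$ means the $(i,j)$ entry of the upper triangular unipotent matrix $U^{-1}$. The form $Q$ is *weakly reduced* if it is positive definite and 1. $N(h_1)=\min\{N(Q(x)):0\ne x\in\mathcal O^n\}$ and $N(h_i)\le\mathfrak d(j-i)\,N(h_j)$ for $1\le i<j\le n$; 2. $h_i^{(\nu)}\le\lambda\,h_i^{(\mu)}$ for all $1\le i\le n$ and all embeddings $\mu,\nu$. It is *balanced HKZ-reduced* if it is weakly reduced and, for $1\le i<j\le n$, the $(i,j)$ inner coefficients of both $Q$ and $Q^{-1}$ lie in $\mathcal E(j-i)$. Forms $Q,Q'$ in $n$ variables are *integrally equivalent* if $Q'=T^tQT$ for some $T\in \mathrm{GL}_n(\mathcal O)$. **Proposition.** For each $d\ge1$ there is a $D_1$ depending only on $d$ that is admissible as above for every totally real $K$ of degree $d$, and for each totally real $K$ there are choices of the $\epsilon_\mu$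 and $\mathcal Y$ as above, and hence a constant $\lambda$. Moreover, if $K$ has class number $1$, then for every admissible $D_1$ and every $\lambda$ arising from such choices, every positive definite quadratic form over $K$, in any number of variables, is integrally equivalent to a balanced HKZ-reduced quadratic form. -/

import Mathlib

open NumberField
open scoped Matrix

universe u

noncomputable section

namespace HumbertReduction

/-! Throughout, `K` is a totally real number field. Its infinite places are the ring homomorphisms
`ν : K →+* ℝ`, with `|a|_ν = |ν a|`, and the algebra `K_∞` is `(K →+* ℝ) → ℝ`.
A quadratic form in `n` variables over `K` is identified with its (symmetric) Gram matrix. -/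

section Constants

variable (K : Type u) [Field K] [NumberField K]

/-- The volume of the `n`-dimensional unit ball, `π ^ (n/2) / Γ(n/2 + 1)`. -/
def ballVolume (n : ℕ) : ℝ :=
  Real.pi ^ ((n : ℝ) / 2) / Real.Gamma ((n : ℝ) / 2 + 1)

/-- `σ_n = 4 ^ d * ω_n ^ (-2d/n) * |d_K|`, where `d = [K : ℚ]`. -/
def sigmaConst (n : ℕ) : ℝ :=
  4 ^ Module.finrank ℚ K *
    ballVolume n ^ (-(2 * (Module.finrank ℚ K : ℝ)) / (n : ℝ)) * |(discr K : ℝ)|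

/-- `α(m) = σ_{m+1} * ∏_{k=2}^{m+1} σ_k ^ (1/(k-1))`. -/
def alphaConst (m : ℕ) : ℝ :=
  sigmaConst K (m + 1) *
    ∏ k ∈ Finset.Icc 2 (m + 1), sigmaConst K k ^ (1 / ((k : ℝ) - 1))

/-- `𝔡(m) = D₁ * |d_K| ^ (1 + Σ(m)) * exp ((d/2) (ln m)²)`, where `Σ(m) = 1 + 1/2 + ⋯ + 1/m`. -/
def growth (D₁ : ℝ) (m : ℕ) : ℝ :=
  D₁ * |(discr K : ℝ)| ^ (1 + ((harmonic m : ℚ) : ℝ)) *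
    Real.exp ((Module.finrank ℚ K : ℝ) / 2 * Real.log m ^ 2)

/-- `D₁` is an allowed choice of the constant in the function `𝔡`. -/
def IsGrowthConstant (D₁ : ℝ) : Prop :=
  ∀ m : ℕ, 1 ≤ m → alphaConst K m ≤ growth K D₁ m ∧ 1 ≤ growth K D₁ m

/-- The covering constant `β` of `𝓞 K` in `K_∞` for the sup norm. -/
def beta : ℝ :=
  sInf {r : ℝ | 0 < r ∧
    ∀ x : (K →+* ℝ) → ℝ, ∃ a : 𝓞 K, ∀ ν : K →+* ℝ, |x ν - ν (a : K)| < r}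

/-- `c(m)` is the coefficient of `x ^ m` in the Maclaurin series of `exp (β x / (1 - x))`. -/
def cCoeff (m : ℕ) : ℝ :=
  PowerSeries.coeff m
    ((PowerSeries.exp ℝ).subst
      (PowerSeries.C (beta K) * PowerSeries.X * (1 - PowerSeries.X : PowerSeries ℝ)⁻¹))

variable {K}

/-- `a` is totally positive. -/
def IsTotPos (a : K) : Prop := ∀ ν : K →+* ℝ, 0 < ν a

/-- The element `a` of `K`, embedded in `K_∞`, lies in `𝓔(m)`. -/
def InE (m : ℕ) (a : K) : Prop := ∀ ν : K →+* ℝ, |ν a| ≤ cCoeff K m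

/-- `y₀` is a nonzero integer minimizing `y ↦ Tr(h y²)` on the nonzero integers. -/
def IsTraceMinimizer (h y₀ : 𝓞 K) : Prop :=
  y₀ ≠ 0 ∧ ∀ y : 𝓞 K, y ≠ 0 →
    Algebra.trace ℚ K ((h : K) * (y₀ : K) ^ 2) ≤ Algebra.trace ℚ K ((h : K) * (y : K) ^ 2)

variable (K)

/-- `lam` is a value of the constant `λ = C * (max |y|_ν / |y|_μ)²`, where
* `ε μ` is, for every infinite place `μ`, a unit that is `> 1` in absolute value at `μ` and `< 1` at
  every other infinite place;
* `C` is the largest value of `(|ε μ|_μ² - 1) / (1 - |ε μ|_ν²)` for `ν ≠ μ`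
  (this is at least `1` if `K` has two or more infinite places; there are no such pairs for `K = ℚ`,
  where `C = 1`, and no condition is put on `ε`);
* `Y` is a finite set of nonzero integers such that, for each totally positive integer `h`, some
  minimizer of `Tr(h y²)` is associated to an element of `Y`; the maximum is over `y ∈ Y` and all
  infinite places `ν`, `μ`. -/
def IsReductionConstant (lam : ℝ) : Prop :=
  ∃ (ε : (K →+* ℝ) → (𝓞 K)ˣ) (Y : Finset (𝓞 K)) (C R : ℝ),
    (∀ μ ν : K →+* ℝ, ν ≠ μ →
      1 < |μ (ε μ : 𝓞 K)| ∧ |ν (ε μ : 𝓞 K)| < 1) ∧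
    IsGreatest (insert 1 {r : ℝ | ∃ μ ν : K →+* ℝ, ν ≠ μ ∧
      r = (|μ (ε μ : 𝓞 K)| ^ 2 - 1) / (1 - |ν (ε μ : 𝓞 K)| ^ 2)}) C ∧
    (∀ y ∈ Y, y ≠ 0) ∧
    (∀ h : 𝓞 K, IsTotPos (h : K) → ∃ y₀ : 𝓞 K, IsTraceMinimizer h y₀ ∧
      ∃ y ∈ Y, Associated y₀ y) ∧
    IsGreatest {r : ℝ | ∃ y ∈ Y, ∃ μ ν : K →+* ℝ, r = |ν (y : K)| / |μ (y : K)|} R ∧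
    lam = C * R ^ 2

end Constants

section Forms

variable {K : Type u} [Field K] [NumberField K] {n : ℕ}

/-- Positive definite quadratic forms over `K`: positive definite at every infinite place. -/
def IsPosDef (Q : Matrix (Fin n) (Fin n) K) : Prop :=
  Q.IsSymm ∧ ∀ ν : K →+* ℝ, (Q.map ν).PosDef

/-- The value `Q(x)` at an integral vector `x`. -/
def value (Q : Matrix (Fin n) (Fin n) K) (x : Fin n → 𝓞 K) : K :=
  ∑ i, ∑ j, (x i : K) * Q i j * (x j : K)

/-- `r` is the minimum `min(Q)` of `N(Q(x))` over the nonzero integral vectors `x`. -/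
def IsMinimum (Q : Matrix (Fin n) (Fin n) K) (r : ℚ) : Prop :=
  IsLeast {s : ℚ | ∃ x : Fin n → 𝓞 K, x ≠ 0 ∧ s = Algebra.norm ℚ (value Q x)} r

/-- Integral equivalence: `Q' = Tᵗ Q T` for some `T ∈ GL_n(𝓞 K)`. -/
def IntegrallyEquivalent (Q Q' : Matrix (Fin n) (Fin n) K) : Prop :=
  ∃ T : GL (Fin n) (𝓞 K),
    Q' = ((T : Matrix (Fin n) (Fin n) (𝓞 K)).map (algebraMap (𝓞 K) K))ᵀ * Q *
      (T : Matrix (Fin n) (Fin n) (𝓞 K)).map (algebraMap (𝓞 K) K)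

/-- Unipotent upper triangular matrices. -/
def IsUpperUnipotent (U : Matrix (Fin n) (Fin n) K) : Prop :=
  (∀ i, U i i = 1) ∧ ∀ i j, j < i → U i j = 0

/-- The Lagrange expansion `Q(x) = ∑ i, h i * (x i + ∑ j > i, U i j * x j)²`, that is,
`Q = Uᵗ diag(h) U`: the `h i` are the outer and the `U i j`, `i < j`, the inner coefficients.
It exists and is unique for positive definite `Q`. -/
def IsLagrangeExpansion (Q : Matrix (Fin n) (Fin n) K) (h : Fin n → K)
    (U : Matrix (Fin n) (Fin n) K) : Prop :=
  IsUpperUnipotent U ∧ Q = Uᵀ * Matrix.diagonal h * U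

/-- The Lagrange expansion with the squares completed in the opposite order of the variables,
`P(x) = ∑ j, g j * (x j + ∑ i < j, W i j * x i)²`, that is, `P = W diag(g) Wᵗ`.
This is the order used for inverse forms: if `Q = Uᵗ diag(h) U` then
`Q⁻¹ = U⁻¹ diag(h)⁻¹ (U⁻¹)ᵗ`, so the inner coefficients of `Q⁻¹` are the entries of `U⁻¹`. -/
def IsDualLagrangeExpansion (P : Matrix (Fin n) (Fin n) K) (g : Fin n → K)
    (W : Matrix (Fin n) (Fin n) K) : Prop :=
  IsUpperUnipotent W ∧ P = W * Matrix.diagonal g * Wᵀ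

/-- Weakly reduced forms, for the constants `D₁` (in `𝔡`) and `lam`. -/
def IsWeaklyReduced (D₁ lam : ℝ) (Q : Matrix (Fin n) (Fin n) K) : Prop :=
  IsPosDef Q ∧ ∃ (h : Fin n → K) (U : Matrix (Fin n) (Fin n) K),
    IsLagrangeExpansion Q h U ∧
    (∀ i : Fin n, (i : ℕ) = 0 → IsMinimum Q (Algebra.norm ℚ (h i))) ∧
    (∀ i j : Fin n, i < j →
      ((Algebra.norm ℚ (h i) : ℚ) : ℝ) ≤
        growth K D₁ ((j : ℕ) - (i : ℕ)) * ((Algebra.norm ℚ (h j) : ℚ) : ℝ)) ∧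
    (∀ (i : Fin n) (μ ν : K →+* ℝ), ν (h i) ≤ lam * μ (h i))

/-- Balanced HKZ-reduced forms: weakly reduced, and for `i < j` the `(i,j)` inner coefficients of
both `Q` and `Q⁻¹` lie in `𝓔(j - i)`. -/
def IsBalancedHKZReduced (D₁ lam : ℝ) (Q : Matrix (Fin n) (Fin n) K) : Prop :=
  IsWeaklyReduced D₁ lam Q ∧
    (∃ (h : Fin n → K) (U : Matrix (Fin n) (Fin n) K), IsLagrangeExpansion Q h U ∧
      ∀ i j : Fin n, i < j → InE ((j : ℕ) - (i : ℕ)) (U i j)) ∧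
    (∃ (g : Fin n → K) (W : Matrix (Fin n) (Fin n) K), IsDualLagrangeExpansion Q⁻¹ g W ∧
      ∀ i j : Fin n, i < j → InE ((j : ℕ) - (i : ℕ)) (W i j))

end Forms

end HumbertReduction

end

/-! The admissible `D₁`. Stirling-type bounds give `σ_k ≤ exp (d ℓ_k) |d_K|` with `ℓ_k = log (k + 2)
- 1 + 2 / k`. Hence `α(m)` is at most `|d_K| ^ (1 + Σ(m))` times the exponential of `d (ℓ_{m+1} + ∑
ℓ_{j+1} / j)`. The sum is `(log m)² / 2 - log m + O(1)`, and its `-log m` cancels the growth of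
`ℓ_{m+1}`, so `D₁ = exp (14 d)` works.

The constant `λ`. Dirichlet's theorem supplies the units. Minkowski's theorem in one variable bounds
the norm of a minimizer of `Tr(h y²)` independently of `h`, so only finitely many principal ideals
occur.

The reduction is made of three integral changes of variables.

1. Class number one makes `𝓞 K` principal, so a vector minimizing `N(Q(x))` may be taken primitive
and extends to a basis. Completing the square and recursing gives an expansion in which each `N(h
i)` is minimal for the corresponding projected form (`exists_isHKZ`). Minkowski's theorem on every
window of consecutive indices, followed by the Lagarias–Lenstra–Schnorr induction, gives `N(h i) ≤
α(j - i) N(h j)` (`IsHKZ.norm_le_alphaConst_mul`).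

2. Multiplying the variables by units keeps the norms of the `h i` and balances their conjugates. If
`y₀` minimizes `Tr(h y²)`, comparison with `y₀ ε_μ` bounds the ratios of the conjugates of `h y₀²`
by `C`; replacing `y₀` by its unit part relative to `𝓨` costs the square of a conjugate ratio
(`exists_unit_balanced`).

3. An integral unipotent change leaves the `h i` alone and turns `U` into `exp N` with all entries
of `N` bounded by `β` (`exists_mul_eq_exp`). The inverse is `exp (-N)`, so one majorization by `exp
(β x / (1 - x))` bounds the inner coefficients of the form and of its inverse together (`inE_exp`).
-/

noncomputable section

namespace HumbertReduction

/-! ### Real embeddings, norm, trace and total positivity. -/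

section Embeddings

variable {K : Type u} [Field K] [NumberField K]

omit [NumberField K] in
theorem mk_ofReal_comp_apply (ν : K →+* ℝ) (x : K) :
    InfinitePlace.mk (Complex.ofRealHom.comp ν) x = |ν x| := by
  simp [InfinitePlace.apply]

omit [NumberField K] in
theorem map_ne_zero_of_ne_zero (ν : K →+* ℝ) {a : 𝓞 K} (ha : a ≠ 0) : ν (a : K) ≠ 0 := by
  simpa using ha

variable [IsTotallyReal K]

omit [NumberField K] in
theorem exists_real_embedding (φ : K →+* ℂ) : ∃ ν : K →+* ℝ, Complex.ofRealHom.comp ν = φ :=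
  ⟨(IsTotallyReal.complexEmbedding_isReal φ).embedding, by
    ext x; simp⟩

variable (K) in
/-- The real embeddings of a totally real field are its complex embeddings. -/
def realEmbeddingEquiv : (K →+* ℝ) ≃ (K →+* ℂ) :=
  Equiv.ofBijective (fun ν => Complex.ofRealHom.comp ν)
    ⟨fun ν μ h => by
      ext x
      have := congrArg (fun f : K →+* ℂ => f x) h
      simpa using this, exists_real_embedding⟩

variable (K) in
theorem card_realEmbeddings : Fintype.card (K →+* ℝ) = Module.finrank ℚ K := by
  rw [Fintype.card_congr (realEmbeddingEquiv K), NumberField.Embeddings.card]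

instance nonempty_realEmbeddings : Nonempty (K →+* ℝ) :=
  (realEmbeddingEquiv K).nonempty

theorem norm_eq_prod_realEmbeddings (x : K) :
    ((Algebra.norm ℚ x : ℚ) : ℝ) = ∏ ν : K →+* ℝ, ν x := by
  have h := Algebra.norm_eq_prod_embeddings ℚ ℂ x
  rw [← Complex.ofReal_inj]
  push_cast
  rw [eq_ratCast] at h
  rw [h]
  symm
  exact Fintype.prod_equiv ((realEmbeddingEquiv K).trans (RingHom.equivRatAlgHom K ℂ)) _ _ fun ν => rfl

theorem trace_eq_sum_realEmbeddings (x : K) :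
    ((Algebra.trace ℚ K x : ℚ) : ℝ) = ∑ ν : K →+* ℝ, ν x := by
  have h := trace_eq_sum_embeddings (K := ℚ) (L := K) ℂ (x := x)
  rw [← Complex.ofReal_inj]
  push_cast
  rw [eq_ratCast] at h
  rw [h]
  symm
  exact Fintype.sum_equiv ((realEmbeddingEquiv K).trans (RingHom.equivRatAlgHom K ℂ)) _ _ fun ν => rfl

theorem IsTotPos.norm_pos {a : K} (ha : IsTotPos a) : 0 < Algebra.norm ℚ a := by
  have : (0 : ℝ) < (Algebra.norm ℚ a : ℚ) := by
    rw [norm_eq_prod_realEmbeddings]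
    exact Finset.prod_pos fun ν _ => ha ν
  exact_mod_cast this

omit [NumberField K] [IsTotallyReal K] in
theorem IsTotPos.mul {a b : K} (ha : IsTotPos a) (hb : IsTotPos b) : IsTotPos (a * b) :=
  fun ν => by rw [map_mul]; exact mul_pos (ha ν) (hb ν)

omit [NumberField K] [IsTotallyReal K] in
theorem isTotPos_sq {a : K} (ha : a ≠ 0) : IsTotPos (a ^ 2) :=
  fun ν => by
    rw [map_pow]
    have : ν a ≠ 0 := by simpa using ha
    positivity

theorem IsTotPos.ne_zero {a : K} (ha : IsTotPos a) : a ≠ 0 := by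
  rintro rfl
  obtain ⟨ν⟩ := (inferInstance : Nonempty (K →+* ℝ))
  simpa using ha ν

omit [IsTotallyReal K] in
theorem one_le_abs_norm {a : 𝓞 K} (ha : a ≠ 0) : 1 ≤ |Algebra.norm ℚ (a : K)| := by
  have h := Algebra.coe_norm_int a
  rw [← h, ← Int.cast_abs]
  exact_mod_cast Int.one_le_abs (Algebra.norm_ne_zero_iff.mpr ha)

omit [IsTotallyReal K] in
theorem one_le_norm_sq {a : 𝓞 K} (ha : a ≠ 0) : 1 ≤ Algebra.norm ℚ ((a : K) ^ 2) := by
  rw [map_pow, ← sq_abs]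
  exact one_le_pow₀ (one_le_abs_norm ha)

omit [IsTotallyReal K] in
theorem norm_unit_sq (e : (𝓞 K)ˣ) : Algebra.norm ℚ (((e : 𝓞 K) : K) ^ 2) = 1 := by
  have h := (NumberField.isUnit_iff_norm (x := (e : 𝓞 K))).mp e.isUnit
  rw [map_pow, ← sq_abs]
  rw [RingOfIntegers.coe_norm] at h
  rw [h, one_pow]

end Embeddings

/-! ### Growth of `α(m)` and the choice of `D₁`. -/

section GrowthConstant

/-- Passing from `x` to `x + 1` multiplies the left side by `x + 1` and the right side by at least
as much, because Bernoulli gives `(1 + 1 / (x + 1)) ^ (x + 1) ≥ 2`. With `x = k / 2` this moves `k`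
by two, hence two base cases in the next lemma. -/
theorem Gamma_add_two_le {x : ℝ} (hx : 0 < x)
    (h : Real.Gamma (x + 1) ≤ 2 * ((x + 1) / 2) ^ x) :
    Real.Gamma (x + 1 + 1) ≤ 2 * ((x + 1 + 1) / 2) ^ (x + 1) := by
  have h1 : (0 : ℝ) < x + 1 := by linarith
  have hb : (2 : ℝ) ≤ (1 + 1 / (x + 1)) ^ (x + 1) := by
    have := one_add_mul_self_le_rpow_one_add (s := 1 / (x + 1))
      (le_trans (by norm_num) (by positivity : (0 : ℝ) ≤ 1 / (x + 1))) (p := x + 1) (by linarith)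
    rw [mul_one_div_cancel h1.ne'] at this
    linarith
  have e : (x + 1 + 1) / 2 = (x + 1) / 2 * (1 + 1 / (x + 1)) := by field_simp
  rw [Real.Gamma_add_one h1.ne', e, Real.mul_rpow (by positivity) (by positivity)]
  have e2 : ((x + 1) / 2) ^ (x + 1) = ((x + 1) / 2) ^ x * ((x + 1) / 2) := by
    rw [Real.rpow_add (by positivity), Real.rpow_one]
  rw [e2]
  have hp : 0 ≤ ((x + 1) / 2) ^ x * ((x + 1) / 2) := by positivity
  calc (x + 1) * Real.Gamma (x + 1) ≤ (x + 1) * (2 * ((x + 1) / 2) ^ x) := by gcongr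
    _ = 2 * (((x + 1) / 2) ^ x * ((x + 1) / 2) * 2) := by ring
    _ ≤ _ := by gcongr

theorem Gamma_half_add_one_le : ∀ k : ℕ, 1 ≤ k →
    Real.Gamma ((k : ℝ) / 2 + 1) ≤ 2 * (((k : ℝ) / 2 + 1) / 2) ^ ((k : ℝ) / 2)
  | 0, h => by omega
  | 1, _ => by
    have h1 : Real.Gamma ((1 : ℝ) / 2 + 1) ≤ 1 := by
      rw [Real.Gamma_add_one (by norm_num), Real.Gamma_one_half_eq]
      have : Real.sqrt Real.pi ≤ 2 := by
        rw [Real.sqrt_le_left (by norm_num)]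
        linarith [Real.pi_le_four]
      linarith
    have h2 : (1 : ℝ) / 2 ≤ (((1 : ℝ) / 2 + 1) / 2) ^ ((1 : ℝ) / 2) := by
      rw [← Real.sqrt_eq_rpow]
      apply Real.le_sqrt_of_sq_le
      norm_num
    push_cast
    linarith
  | 2, _ => by
    norm_num
  | k + 3, _ => by
    have ih := Gamma_half_add_one_le (k + 1) (by omega)
    have := Gamma_add_two_le (x := ((k + 1 : ℕ) : ℝ) / 2) (by positivity) ih
    convert this using 2 <;> push_cast <;> ring_nf

/-- The exponent in the bound `σ_k ≤ exp (d ℓ_k) |d_K|`. -/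
def sigmaExponent (k : ℕ) : ℝ := Real.log ((k : ℝ) + 2) - 1 + 2 / k

/-- The base of the Gamma bound is `(k + 2) / 4`, and this `4` cancels the factor `4 ^ d`. -/
theorem four_pow_mul_ballVolume_rpow_le (d : ℝ) (hd : 0 ≤ d) {k : ℕ} (hk : 1 ≤ k) :
    4 ^ d * ballVolume k ^ (-(2 * d) / (k : ℝ)) ≤ Real.exp (d * sigmaExponent k) := by
  have hk0 : (0 : ℝ) < k := by exact_mod_cast hk
  have hG : 0 < Real.Gamma ((k : ℝ) / 2 + 1) := Real.Gamma_pos_of_pos (by positivity)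
  have hb : 0 < ballVolume k := by unfold ballVolume; positivity
  have hlogb : Real.log (ballVolume k)
      = (k : ℝ) / 2 * Real.log Real.pi - Real.log (Real.Gamma ((k : ℝ) / 2 + 1)) := by
    unfold ballVolume
    rw [Real.log_div (by positivity) hG.ne', Real.log_rpow Real.pi_pos]
  have hlogG : Real.log (Real.Gamma ((k : ℝ) / 2 + 1))
      ≤ Real.log 2 + (k : ℝ) / 2 * (Real.log ((k : ℝ) + 2) - Real.log 4) := by
    refine (Real.log_le_log hG (Gamma_half_add_one_le k hk)).trans ?_
    rw [Real.log_mul (by norm_num) (by positivity), Real.log_rpow (by positivity),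
      ← Real.log_div (by positivity) (by norm_num)]
    apply le_of_eq
    congr 3
    ring
  -- This is the source of the `-1` in `sigmaExponent`, which later yields the essential `-log m`.
  have hpi : 1 ≤ Real.log Real.pi := by
    rw [Real.le_log_iff_exp_le Real.pi_pos]
    linarith [Real.exp_one_lt_d9, Real.pi_gt_three]
  have hl2 : Real.log 2 ≤ 1 := by linarith [Real.log_two_lt_d9]
  rw [Real.rpow_def_of_pos (by norm_num : (0 : ℝ) < 4), Real.rpow_def_of_pos hb, ← Real.exp_add,
    Real.exp_le_exp, hlogb]
  unfold sigmaExponent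
  have e : Real.log 4 * d + ((k : ℝ) / 2 * Real.log Real.pi
      - Real.log (Real.Gamma ((k : ℝ) / 2 + 1))) * (-(2 * d) / k)
      = d * (Real.log 4 - Real.log Real.pi
        + 2 / k * Real.log (Real.Gamma ((k : ℝ) / 2 + 1))) := by
    field_simp
    ring
  rw [e]
  refine mul_le_mul_of_nonneg_left ?_ hd
  have h3 : 2 / k * Real.log (Real.Gamma ((k : ℝ) / 2 + 1))
      ≤ 2 / k * (Real.log 2 + (k : ℝ) / 2 * (Real.log ((k : ℝ) + 2) - Real.log 4)) := by gcongr
  have h4 : 2 / k * (Real.log 2 + (k : ℝ) / 2 * (Real.log ((k : ℝ) + 2) - Real.log 4))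
      = 2 / k * Real.log 2 + (Real.log ((k : ℝ) + 2) - Real.log 4) := by
    field_simp
  have h5 : 2 / (k : ℝ) * Real.log 2 ≤ 2 / k := mul_le_of_le_one_right (by positivity) hl2
  linarith

/-- A discrete form of `∫ (log x / x - 1 / x) = (log x)² / 2 - log x`. The term `-7 / m` is slack
that absorbs the errors of order `1 / m²` and lets the induction close; `11 - 7 = 4` is the bound on
the first term. -/
theorem sum_sigmaExponent_le {m : ℕ} (hm : 1 ≤ m) :
    ∑ j ∈ Finset.Icc 1 m, sigmaExponent (j + 1) / j
      ≤ Real.log m ^ 2 / 2 - Real.log m + 11 - 7 / m := by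
  have hterm : ∀ j : ℕ, 1 ≤ j →
      sigmaExponent (j + 1) / j ≤ Real.log j / j - 1 / j + 5 / (j : ℝ) ^ 2 := by
    intro j hj
    have hj0 : (0 : ℝ) < j := by exact_mod_cast hj
    unfold sigmaExponent
    have h1 : Real.log (((j + 1 : ℕ) : ℝ) + 2) ≤ Real.log j + 3 / j := by
      have : ((j + 1 : ℕ) : ℝ) + 2 = j * (1 + 3 / j) := by push_cast; field_simp; ring
      rw [this, Real.log_mul hj0.ne' (by positivity)]
      have := Real.log_le_sub_one_of_pos (x := 1 + 3 / (j : ℝ)) (by positivity)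
      linarith
    have h2 : 2 / ((j + 1 : ℕ) : ℝ) ≤ 2 / j := by
      gcongr
      linarith
    calc _ ≤ (Real.log j + 3 / j - 1 + 2 / j) / j := by gcongr
      _ = _ := by field_simp; ring
  induction m, hm using Nat.le_induction with
  | base =>
    have := hterm 1 le_rfl
    simp only [Finset.Icc_self, Finset.sum_singleton]
    norm_num at this ⊢
    linarith
  | succ m hm ih =>
    have hm0 : (0 : ℝ) < m := by exact_mod_cast hm
    rw [Finset.sum_Icc_succ_top (by omega)]
    have h1 := hterm (m + 1) (by omega)
    push_cast at h1 ⊢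
    set a := Real.log m
    set b := Real.log ((m : ℝ) + 1)
    have hδ1 : b - a ≤ 1 / m := by
      have := Real.log_le_sub_one_of_pos (x := ((m : ℝ) + 1) / m) (by positivity)
      rw [Real.log_div (by positivity) hm0.ne'] at this
      have e : ((m : ℝ) + 1) / m - 1 = 1 / m := by field_simp; ring
      linarith
    have hδ2 : 1 / ((m : ℝ) + 1) ≤ b - a := by
      have := Real.one_sub_inv_le_log_of_pos (x := ((m : ℝ) + 1) / m) (by positivity)
      rw [Real.log_div (by positivity) hm0.ne'] at this
      have e : 1 - (((m : ℝ) + 1) / m)⁻¹ = 1 / (m + 1) := by field_simp; ring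
      linarith
    have hb : 0 ≤ b := Real.log_nonneg (by linarith)
    have hδ0 : 0 ≤ b - a := le_trans (by positivity) hδ2
    have hsq : (b - a) ^ 2 ≤ (1 / (m : ℝ)) ^ 2 := by gcongr
    have hprod : b / ((m : ℝ) + 1) ≤ b * (b - a) := by
      rw [div_eq_mul_one_div]
      gcongr
    have hid : b ^ 2 / 2 - a ^ 2 / 2 = b * (b - a) - (b - a) ^ 2 / 2 := by ring
    have hrat : -(1 / ((m : ℝ) + 1)) + 5 / ((m : ℝ) + 1) ^ 2 - 7 / m + 7 / (m + 1)
        + (1 / (m : ℝ)) ^ 2 / 2 + 1 / m ≤ 0 := by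
      have e : -(1 / ((m : ℝ) + 1)) + 5 / ((m : ℝ) + 1) ^ 2 - 7 / m + 7 / (m + 1)
        + (1 / (m : ℝ)) ^ 2 / 2 + 1 / m
        = (-(12 * m * (m + 1)) + 10 * m ^ 2 + (m + 1) ^ 2) / (2 * (m : ℝ) ^ 2 * (m + 1) ^ 2) := by
        field_simp
        ring
      rw [e]
      apply div_nonpos_of_nonpos_of_nonneg _ (by positivity)
      have : (1 : ℝ) ≤ m := by exact_mod_cast hm
      nlinarith
    linarith

theorem harmonic_eq_sum_real (m : ℕ) :
    ((harmonic m : ℚ) : ℝ) = ∑ j ∈ Finset.Icc 1 m, (1 : ℝ) / j := by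
  rw [harmonic_eq_sum_Icc]
  push_cast
  simp

variable (K : Type u) [Field K] [NumberField K]

theorem one_le_abs_discr : (1 : ℝ) ≤ |(discr K : ℝ)| := by
  rw [← Int.cast_abs]
  exact_mod_cast Int.one_le_abs (discr_ne_zero K)

theorem ballVolume_pos (n : ℕ) : 0 < ballVolume n := by
  have : 0 < Real.Gamma ((n : ℝ) / 2 + 1) := Real.Gamma_pos_of_pos (by positivity)
  unfold ballVolume
  positivity

theorem sigmaConst_pos (n : ℕ) : 0 < sigmaConst K n := by
  have := one_le_abs_discr K
  have := ballVolume_pos n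
  unfold sigmaConst
  positivity

theorem sigmaConst_le {k : ℕ} (hk : 1 ≤ k) :
    sigmaConst K k ≤
      Real.exp (Module.finrank ℚ K * sigmaExponent k) * |(discr K : ℝ)| := by
  unfold sigmaConst
  gcongr
  rw [← Real.rpow_natCast]
  exact four_pow_mul_ballVolume_rpow_le _ (Nat.cast_nonneg _) hk

/-- The `log m` in the exponent of `σ_{m+1}` cancels the `-log m` of the sum. The constant is `14 =
3 + 11`. -/
theorem alphaConst_le {m : ℕ} (hm : 1 ≤ m) :
    alphaConst K m ≤ Real.exp (Module.finrank ℚ K * 14) *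
      |(discr K : ℝ)| ^ (1 + ((harmonic m : ℚ) : ℝ)) *
        Real.exp ((Module.finrank ℚ K : ℝ) / 2 * Real.log m ^ 2) := by
  set d : ℝ := (Module.finrank ℚ K : ℝ)
  set D : ℝ := |(discr K : ℝ)|
  have hD : 1 ≤ D := one_le_abs_discr K
  have hD0 : 0 < D := by linarith
  have hm0 : (0 : ℝ) < m := by exact_mod_cast hm
  have hprod : ∏ k ∈ Finset.Icc 2 (m + 1), sigmaConst K k ^ (1 / ((k : ℝ) - 1))
      ≤ Real.exp (d * ∑ j ∈ Finset.Icc 1 m, sigmaExponent (j + 1) / j) *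
        D ^ ((harmonic m : ℚ) : ℝ) := by
    have e : Finset.Icc 2 (m + 1) = (Finset.Icc 1 m).map (addRightEmbedding 1) := by
      rw [Finset.map_add_right_Icc]
    rw [e, Finset.prod_map, harmonic_eq_sum_real, Real.rpow_sum_of_pos hD0, Finset.mul_sum,
      Real.exp_sum, ← Finset.prod_mul_distrib]
    refine Finset.prod_le_prod (fun j _ => (Real.rpow_pos_of_pos (sigmaConst_pos K _) _).le) ?_
    intro j hj
    have hj0 : (0 : ℝ) < j := by exact_mod_cast (Finset.mem_Icc.mp hj).1
    simp only [addRightEmbedding_apply]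
    have e1 : (((j + 1 : ℕ) : ℝ) - 1) = j := by push_cast; ring
    rw [e1]
    calc sigmaConst K (j + 1) ^ (1 / (j : ℝ))
        ≤ (Real.exp (d * sigmaExponent (j + 1)) * D) ^ (1 / (j : ℝ)) :=
          Real.rpow_le_rpow (sigmaConst_pos K _).le (sigmaConst_le K (by omega)) (by positivity)
      _ = _ := by
          rw [Real.mul_rpow (by positivity) hD0.le, ← Real.exp_mul]
          congr 2
          ring
  have hS := sum_sigmaExponent_le hm
  have hL : sigmaExponent (m + 1) ≤ Real.log m + 3 := by
    unfold sigmaExponent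
    have h1 : Real.log (((m + 1 : ℕ) : ℝ) + 2) ≤ Real.log m + 3 / m := by
      have : ((m + 1 : ℕ) : ℝ) + 2 = m * (1 + 3 / m) := by push_cast; field_simp; ring
      rw [this, Real.log_mul hm0.ne' (by positivity)]
      have := Real.log_le_sub_one_of_pos (x := 1 + 3 / (m : ℝ)) (by positivity)
      linarith
    have hm1 : (1 : ℝ) ≤ m := by exact_mod_cast hm
    have h2 : 2 / ((m + 1 : ℕ) : ℝ) ≤ 1 := by
      rw [div_le_one (by positivity)]
      push_cast
      linarith
    have h3 : 3 / (m : ℝ) ≤ 3 := div_le_self (by norm_num) hm1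
    linarith
  have hd : 0 ≤ d := Nat.cast_nonneg _
  have h7 : 0 ≤ 7 / (m : ℝ) := by positivity
  calc alphaConst K m
      ≤ (Real.exp (d * sigmaExponent (m + 1)) * D) *
        (Real.exp (d * ∑ j ∈ Finset.Icc 1 m, sigmaExponent (j + 1) / j) *
          D ^ ((harmonic m : ℚ) : ℝ)) := by
        unfold alphaConst
        refine mul_le_mul (sigmaConst_le K (by omega)) hprod ?_ (by positivity)
        exact Finset.prod_nonneg fun k _ => (Real.rpow_pos_of_pos (sigmaConst_pos K _) _).le
    _ = Real.exp (d * (sigmaExponent (m + 1)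
          + ∑ j ∈ Finset.Icc 1 m, sigmaExponent (j + 1) / j)) *
        D ^ (1 + ((harmonic m : ℚ) : ℝ)) := by
        rw [Real.rpow_add hD0, Real.rpow_one, mul_add, Real.exp_add]
        ring
    _ ≤ Real.exp (d * (14 + Real.log m ^ 2 / 2)) * D ^ (1 + ((harmonic m : ℚ) : ℝ)) := by
        have : sigmaExponent (m + 1) + ∑ j ∈ Finset.Icc 1 m, sigmaExponent (j + 1) / j
            ≤ 14 + Real.log m ^ 2 / 2 := by linarith
        gcongr
    _ = _ := by
        rw [mul_add, Real.exp_add]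
        have : d * (Real.log m ^ 2 / 2) = d / 2 * Real.log m ^ 2 := by ring
        rw [this]
        ring

theorem isGrowthConstant_exp :
    IsGrowthConstant K (Real.exp ((Module.finrank ℚ K : ℝ) * 14)) := by
  refine fun m hm => ⟨alphaConst_le K hm, ?_⟩
  unfold growth
  have h1 : 1 ≤ Real.exp ((Module.finrank ℚ K : ℝ) * 14) := Real.one_le_exp (by positivity)
  have h2 : 1 ≤ |(discr K : ℝ)| ^ (1 + ((harmonic m : ℚ) : ℝ)) := by
    refine Real.one_le_rpow (one_le_abs_discr K) ?_
    rw [harmonic_eq_sum_real]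
    positivity
  have h3 : 1 ≤ Real.exp ((Module.finrank ℚ K : ℝ) / 2 * Real.log m ^ 2) :=
    Real.one_le_exp (by positivity)
  exact one_le_mul_of_one_le_of_one_le (one_le_mul_of_one_le_of_one_le h1 h2) h3

end GrowthConstant

/-! ### Minkowski's theorem for products of Euclidean balls. -/

section Minkowski

open MeasureTheory

variable {ι V : Type*} [Fintype ι] [Fintype V]

theorem volume_preserving_uncurry_swap :
    MeasurePreserving (fun (f : V → ι → ℝ) (p : ι × V) => f p.2 p.1) volume volume := by
  have hm : Measurable (fun (f : V → ι → ℝ) (p : ι × V) => f p.2 p.1) := by fun_prop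
  refine ⟨hm, ?_⟩
  symm
  refine Measure.pi_eq fun s hs => ?_
  rw [Measure.map_apply hm (MeasurableSet.univ_pi hs)]
  have e : (fun (f : V → ι → ℝ) (p : ι × V) => f p.2 p.1) ⁻¹' (Set.univ.pi s)
      = Set.univ.pi fun v => Set.univ.pi fun i => s (i, v) := by
    ext f
    simp only [Set.mem_preimage, Set.mem_pi, Set.mem_univ, true_imp_iff, Prod.forall]
    exact forall_comm
  rw [e, volume_pi_pi, Fintype.prod_prod_type_right]
  simp_rw [volume_pi_pi]

theorem volume_setOf_sum_sq_le [Nonempty ι] (t : ℝ) (ht : 0 ≤ t) :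
    volume {z : ι → ℝ | ∑ l, z l ^ 2 ≤ t}
      = ENNReal.ofReal (√t ^ Fintype.card ι * ballVolume (Fintype.card ι)) := by
  have h := EuclideanSpace.volume_closedBall ι (0 : EuclideanSpace ℝ ι) (√t)
  have e : WithLp.toLp 2 ⁻¹' (Metric.closedBall (0 : EuclideanSpace ℝ ι) (√t))
      = {z : ι → ℝ | ∑ l, z l ^ 2 ≤ t} := by
    ext z
    simp [EuclideanSpace.norm_eq, Real.sqrt_le_sqrt_iff ht]
  rw [← e, (PiLp.volume_preserving_toLp ι).measure_preimage
    Metric.isClosed_closedBall.measurableSet.nullMeasurableSet, h, ballVolume,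
    ENNReal.ofReal_mul (by positivity), ENNReal.ofReal_pow (by positivity)]
  congr 3
  rw [Real.sqrt_eq_rpow, ← Real.rpow_natCast, ← Real.rpow_mul Real.pi_pos.le]
  congr 1
  ring

theorem volume_setOf_forall_sum_sq_le [Nonempty ι] (t : ℝ) (ht : 0 ≤ t) :
    volume {z : ι × V → ℝ | ∀ v, ∑ l, z (l, v) ^ 2 ≤ t}
      = ENNReal.ofReal
        ((√t ^ Fintype.card ι * ballVolume (Fintype.card ι)) ^ Fintype.card V) := by
  have hm : MeasurableSet {z : ι × V → ℝ | ∀ v, ∑ l, z (l, v) ^ 2 ≤ t} := by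
    refine IsClosed.measurableSet ?_
    simp only [Set.ofPred_forall]
    exact isClosed_iInter fun v => isClosed_le (by fun_prop) continuous_const
  rw [← volume_preserving_uncurry_swap.measure_preimage hm.nullMeasurableSet]
  have e : (fun (f : V → ι → ℝ) (p : ι × V) => f p.2 p.1) ⁻¹'
      {z : ι × V → ℝ | ∀ v, ∑ l, z (l, v) ^ 2 ≤ t}
      = Set.univ.pi fun _ => {z : ι → ℝ | ∑ l, z l ^ 2 ≤ t} := by
    ext f
    simp
  have hb := ballVolume_pos (Fintype.card ι)
  rw [e, volume_pi_pi, Finset.prod_const, volume_setOf_sum_sq_le t ht, Finset.card_univ,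
    ← ENNReal.ofReal_pow (by positivity)]

theorem sq_convexOn_sum : ConvexOn ℝ Set.univ fun z : ι → ℝ => ∑ l, z l ^ 2 := by
  have h : ∀ l ∈ (Finset.univ : Finset ι), ConvexOn ℝ Set.univ fun z : ι → ℝ => z l ^ 2 :=
    fun l _ => (even_two.convexOn_pow (𝕜 := ℝ)).comp_linearMap
      (LinearMap.proj l : (ι → ℝ) →ₗ[ℝ] ℝ)
  have := Finset.sum_induction (M := (ι → ℝ) → ℝ) (fun l z => z l ^ 2)
    (fun f => ConvexOn ℝ Set.univ f) (s := Finset.univ)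
    (fun a b ha hb => ha.add hb) (convexOn_const 0 convex_univ) h
  convert this using 2
  simp

/-- Minkowski's theorem for the lattice spanned by the rows of `G` and a product of balls. -/
theorem exists_int_combination_in_balls [Nonempty ι] [Nonempty V] [DecidableEq ι] [DecidableEq V]
    (G : Matrix (ι × V) (ι × V) ℝ) (hG : G.det ≠ 0) (t : ℝ) (ht : 0 ≤ t)
    (h : |G.det| * 2 ^ (Fintype.card ι * Fintype.card V) ≤
      (√t ^ Fintype.card ι * ballVolume (Fintype.card ι)) ^ Fintype.card V) :
    ∃ c : ι × V → ℤ, c ≠ 0 ∧ ∀ v, ∑ l, (∑ p, (c p : ℝ) * G p (l, v)) ^ 2 ≤ t := by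
  let b : Module.Basis (ι × V) ℝ (ι × V → ℝ) :=
    basisOfLinearIndependentOfCardEqFinrank (Matrix.linearIndependent_rows_of_det_ne_zero hG)
      (by simp)
  have hb : ⇑b = G.row := coe_basisOfLinearIndependentOfCardEqFinrank _ _
  have hb' : (Matrix.of b) = G := by rw [hb]; rfl
  set S : Set (ι × V → ℝ) := {z | ∀ v, ∑ l, z (l, v) ^ 2 ≤ t} with hS
  have hclosed : IsClosed S := by
    simp only [hS, Set.ofPred_forall]
    exact isClosed_iInter fun v => isClosed_le (by fun_prop) continuous_const
  -- Compactness permits a non-strict volume inequality in Minkowski's theorem.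
  have hcompact : IsCompact S := by
    refine Metric.isCompact_of_isClosed_isBounded hclosed ?_
    refine (Metric.isBounded_closedBall (x := (0 : ι × V → ℝ)) (r := √t)).subset ?_
    intro z hz
    rw [mem_closedBall_zero_iff, pi_norm_le_iff_of_nonneg (Real.sqrt_nonneg t)]
    rintro ⟨l, v⟩
    rw [Real.norm_eq_abs]
    refine Real.abs_le_sqrt ?_
    exact (Finset.single_le_sum (f := fun l => z (l, v) ^ 2) (fun i _ => sq_nonneg _)
      (Finset.mem_univ l)).trans (hz v)
  have hconv : Convex ℝ S := by
    simp only [hS, Set.ofPred_forall]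
    refine convex_iInter fun v => ?_
    have := ((sq_convexOn_sum (ι := ι)).comp_linearMap
      (LinearMap.funLeft ℝ ℝ fun l : ι => (l, v))).convex_le t
    simpa [LinearMap.funLeft] using this
  have hsymm : ∀ x ∈ S, -x ∈ S := fun x hx v => by simpa using hx v
  have hvol : volume (ZSpan.fundamentalDomain b) * 2 ^ Module.finrank ℝ (ι × V → ℝ)
      ≤ volume S := by
    rw [ZSpan.volume_fundamentalDomain, hb', hS, volume_setOf_forall_sum_sq_le t ht,
      Module.finrank_fintype_fun_eq_card, Fintype.card_prod]
    have e2 : (2 : ENNReal) = ENNReal.ofReal 2 := by simp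
    rw [e2, ← ENNReal.ofReal_pow (by norm_num), ← ENNReal.ofReal_mul (abs_nonneg _)]
    exact ENNReal.ofReal_le_ofReal h
  have : Countable (Submodule.span ℤ (Set.range b)).toAddSubgroup :=
    inferInstanceAs (Countable (Submodule.span ℤ (Set.range b)))
  have : DiscreteTopology (Submodule.span ℤ (Set.range b)).toAddSubgroup :=
    inferInstanceAs (DiscreteTopology (Submodule.span ℤ (Set.range b)))
  obtain ⟨x, hx0, hxS⟩ := exists_ne_zero_mem_lattice_of_measure_mul_two_pow_le_measure
    (ZSpan.isAddFundamentalDomain' b volume) hsymm hconv hcompact hvol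
  obtain ⟨c, hc⟩ := (Submodule.mem_span_range_iff_exists_fun ℤ).mp x.2
  have hval : ∀ q, (x : ι × V → ℝ) q = ∑ p, (c p : ℝ) * G p q := by
    intro q
    rw [← hc, Finset.sum_apply]
    refine Finset.sum_congr rfl fun p _ => ?_
    rw [hb]
    simp [Matrix.row]
  refine ⟨c, ?_, fun v => ?_⟩
  · rintro rfl
    apply hx0
    ext q
    rw [hval]
    simp
  · have := hxS v
    simpa only [hval] using this

end Minkowski

/-! ### Small values of forms over `K`. -/

section Forms

variable {K : Type u} [Field K] [NumberField K] [IsTotallyReal K]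

/-- The value at `y` of the form `∑ l, h l * (A y)_l²`. -/
def diagValue {ι : Type*} [Fintype ι] (h : ι → K) (A : Matrix ι ι K) (y : ι → 𝓞 K) : K :=
  ∑ l, h l * (∑ s, A l s * (y s : K)) ^ 2

theorem exists_integralBasis_indexed :
    Nonempty (Module.Basis (K →+* ℝ) ℤ (𝓞 K)) := by
  refine ⟨(RingOfIntegers.basis K).reindex (Fintype.equivOfCardEq ?_)⟩
  rw [card_realEmbeddings, ← RingOfIntegers.rank, Module.finrank_eq_card_chooseBasisIndex]

-- The trace matrix of the basis is `M Mᵀ`, where `M` is the matrix of conjugates.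
open scoped Classical in
theorem det_sq_eq_discr (b : Module.Basis (K →+* ℝ) ℤ (𝓞 K)) :
    (Matrix.of fun (p ν : K →+* ℝ) => ν (b p : K)).det ^ 2 = (discr K : ℝ) := by
  rw [← discr_eq_discr K b, Algebra.discr_def, ← eq_intCast (Int.castRingHom ℝ),
    RingHom.map_det, sq]
  nth_rewrite 2 [← Matrix.det_transpose]
  rw [← Matrix.det_mul]
  congr 1
  ext p q
  rw [Matrix.mul_apply]
  simp only [RingHom.mapMatrix_apply, Matrix.map_apply, Algebra.traceMatrix_apply,
    Algebra.traceForm_apply, Matrix.transpose_apply, Matrix.of_apply, eq_intCast]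
  have h := trace_eq_sum_realEmbeddings ((b p * b q : 𝓞 K) : K)
  rw [← Algebra.coe_trace_int, Rat.cast_intCast] at h
  rw [h]
  simp

-- Embed `y` with coordinates `√(ν (h l)) * ν ((A y)_l)`: the sum of squares over `l` at the place
-- `ν` is then the `ν`-conjugate of the value. The image of `𝓞 K ^ ι` is a lattice whose squared
-- covolume is `|d_K| ^ n ∏ N(h l)`, and `σ_n` is the constant that Minkowski's theorem produces
-- from it.
open scoped Classical Kronecker in
theorem exists_diagValue_le {ι : Type*} [Fintype ι] [DecidableEq ι] [Nonempty ι]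
    (h : ι → K) (hh : ∀ l, IsTotPos (h l)) (A : Matrix ι ι K) (hA : A.det = 1)
    (t : ℝ) (ht : 0 ≤ t)
    (hbound : (sigmaConst K (Fintype.card ι)) ^ Fintype.card ι *
      ∏ l, ((Algebra.norm ℚ (h l) : ℚ) : ℝ) ≤ (t ^ Module.finrank ℚ K) ^ Fintype.card ι) :
    ∃ y : ι → 𝓞 K, y ≠ 0 ∧ ∀ ν : K →+* ℝ, ν (diagValue h A y) ≤ t := by
  obtain ⟨b⟩ := exists_integralBasis_indexed (K := K)
  set M : Matrix (K →+* ℝ) (K →+* ℝ) ℝ := Matrix.of fun p ν => ν (b p : K) with hM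
  set R : (K →+* ℝ) → Matrix ι ι ℝ :=
    fun ν => (A.map ν)ᵀ * Matrix.diagonal fun l => √(ν (h l)) with hR
  set G : Matrix (ι × (K →+* ℝ)) (ι × (K →+* ℝ)) ℝ :=
    ((1 : Matrix ι ι ℝ) ⊗ₖ M) * Matrix.blockDiagonal R with hGdef
  have hRapp : ∀ ν i l, R ν i l = ν (A l i) * √(ν (h l)) := by
    intro ν i l
    simp only [hR]
    rw [Matrix.mul_diagonal, Matrix.transpose_apply, Matrix.map_apply]
  have hGapp : ∀ i p l ν, G (i, p) (l, ν) = ν (b p : K) * (ν (A l i) * √(ν (h l))) := by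
    intro i p l ν
    simp only [hGdef, Matrix.mul_apply, Fintype.sum_prod_type, Matrix.kroneckerMap_apply,
      Matrix.blockDiagonal_apply, Matrix.one_apply, hM, hRapp, Matrix.of_apply]
    simp
  have hdetR : ∀ ν, (R ν).det = ∏ l, √(ν (h l)) := by
    intro ν
    have : (A.map ν).det = 1 := by
      have := RingHom.map_det ν A
      rw [hA, map_one] at this
      exact this.symm
    rw [hR, Matrix.det_mul, Matrix.det_transpose, this, one_mul, Matrix.det_diagonal]
  have hdet : G.det = M.det ^ Fintype.card ι * ∏ ν : K →+* ℝ, ∏ l, √(ν (h l)) := by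
    rw [hGdef, Matrix.det_mul, Matrix.det_kronecker, Matrix.det_one, one_pow, one_mul,
      Matrix.det_blockDiagonal]
    simp_rw [hdetR]
  have hMsq : M.det ^ 2 = (discr K : ℝ) := det_sq_eq_discr b
  have hprodsq : (∏ ν : K →+* ℝ, ∏ l, √(ν (h l))) ^ 2
      = ∏ l, ((Algebra.norm ℚ (h l) : ℚ) : ℝ) := by
    rw [Finset.prod_comm, ← Finset.prod_pow]
    refine Finset.prod_congr rfl fun l _ => ?_
    rw [norm_eq_prod_realEmbeddings, ← Finset.prod_pow]
    exact Finset.prod_congr rfl fun ν _ => Real.sq_sqrt (hh l ν).le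
  have hM0 : M.det ≠ 0 := by
    intro h0
    have := one_le_abs_discr K
    rw [← hMsq, h0] at this
    norm_num at this
  have hprodpos : 0 < ∏ ν : K →+* ℝ, ∏ l, √(ν (h l)) :=
    Finset.prod_pos fun ν _ => Finset.prod_pos fun l _ => Real.sqrt_pos.mpr (hh l ν)
  have hG0 : G.det ≠ 0 := by
    rw [hdet]
    exact mul_ne_zero (pow_ne_zero _ hM0) hprodpos.ne'
  set n := Fintype.card ι with hn
  have hn0 : n ≠ 0 := Fintype.card_ne_zero
  set d := Module.finrank ℚ K with hd
  have hcard : Fintype.card (K →+* ℝ) = d := card_realEmbeddings K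
  have hbv := ballVolume_pos n
  obtain ⟨c, hc0, hc⟩ := exists_int_combination_in_balls G hG0 t ht (by
    rw [hcard]
    -- Comparing squares removes the roots of `t` and of the `ν (h l)` and brings in the
    -- discriminant and the norms.
    rw [← abs_of_nonneg (a := (√t ^ n * ballVolume n) ^ d) (by positivity),
      ← abs_of_nonneg (a := (2 : ℝ) ^ (n * d)) (by positivity), ← abs_mul]
    refine sq_le_sq.mp ?_
    have hsig : sigmaConst K n ^ n
        = (2 ^ (n * d)) ^ 2 * |(discr K : ℝ)| ^ n * ((ballVolume n ^ d) ^ 2)⁻¹ := by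
      unfold sigmaConst
      rw [mul_pow, mul_pow, ← Real.rpow_natCast (ballVolume n ^ _), ← Real.rpow_mul hbv.le,
        ← hd]
      have e : -(2 * (d : ℝ)) / n * n = -((2 * d : ℕ) : ℝ) := by
        push_cast
        field_simp
      rw [e, Real.rpow_neg hbv.le, Real.rpow_natCast, ← pow_mul, ← pow_mul, ← pow_mul]
      rw [show (4 : ℝ) = 2 ^ 2 by norm_num, ← pow_mul, mul_comm 2 d]
      ring
    rw [hsig] at hbound
    have e1 : (G.det * 2 ^ (n * d)) ^ 2 = (2 ^ (n * d)) ^ 2 * |(discr K : ℝ)| ^ n *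
        ∏ l, ((Algebra.norm ℚ (h l) : ℚ) : ℝ) := by
      have hD : |(discr K : ℝ)| = M.det ^ 2 := by
        rw [← hMsq, abs_of_nonneg (sq_nonneg _)]
      rw [hdet, mul_pow, mul_pow, hprodsq, hD]
      ring
    have e2 : ((√t ^ n * ballVolume n) ^ d) ^ 2 = (t ^ d) ^ n * (ballVolume n ^ d) ^ 2 := by
      have : √t ^ 2 = t := Real.sq_sqrt ht
      nth_rewrite 2 [← this]
      ring
    rw [e1, e2]
    have hW : 0 < (ballVolume n ^ d) ^ 2 := by positivity
    calc _ = ((2 ^ (n * d)) ^ 2 * |(discr K : ℝ)| ^ n * ((ballVolume n ^ d) ^ 2)⁻¹ *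
        ∏ l, ((Algebra.norm ℚ (h l) : ℚ) : ℝ)) * (ballVolume n ^ d) ^ 2 := by
          field_simp
      _ ≤ _ := by gcongr)
  refine ⟨fun i => ∑ p, c (i, p) • b p, ?_, fun ν => ?_⟩
  · intro h0
    apply hc0
    ext ⟨i, p⟩
    have h1 : ∑ p, c (i, p) • b p = 0 := congrFun h0 i
    exact Fintype.linearIndependent_iff.mp b.linearIndependent _ h1 p
  · refine le_trans (le_of_eq ?_) (hc ν)
    unfold diagValue
    rw [map_sum]
    refine Finset.sum_congr rfl fun l _ => ?_
    have e : ∑ p, (c p : ℝ) * G p (l, ν)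
        = √(ν (h l)) * ν (∑ s, A l s * ((∑ p, c (s, p) • b p : 𝓞 K) : K)) := by
      rw [Fintype.sum_prod_type, map_sum, Finset.mul_sum]
      refine Finset.sum_congr rfl fun i _ => ?_
      simp only [hGapp, map_mul, map_sum, zsmul_eq_mul, map_intCast, Finset.mul_sum]
      refine Finset.sum_congr rfl fun p _ => ?_
      ring
    rw [e, mul_pow, Real.sq_sqrt (hh l ν).le, map_mul, map_pow]

end Forms

/-! ### Existence of the units, of the set of minimizers and of `λ`. -/

section ReductionConstant

variable {K : Type u} [Field K] [NumberField K] [IsTotallyReal K]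

theorem exists_isGreatest_of_finite {s : Set ℝ} (hs : s.Finite) (hne : s.Nonempty) :
    ∃ C, IsGreatest s C := by
  obtain ⟨C, hC, hmax⟩ := Set.exists_max_image s id hs hne
  exact ⟨C, hC, fun x hx => hmax x hx⟩

omit [NumberField K] [IsTotallyReal K] in
theorem mk_ofReal_comp_injective {μ ν : K →+* ℝ}
    (h : InfinitePlace.mk (Complex.ofRealHom.comp ν) = InfinitePlace.mk (Complex.ofRealHom.comp μ)) :
    ν = μ := by
  have hc : ComplexEmbedding.conjugate (Complex.ofRealHom.comp ν) = Complex.ofRealHom.comp ν := by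
    ext x
    simp [ComplexEmbedding.conjugate_coe_eq]
  rw [InfinitePlace.mk_eq_iff, hc, or_self] at h
  ext x
  have := congrArg (fun f : K →+* ℂ => f x) h
  simpa using this

theorem prod_abs_unit (e : (𝓞 K)ˣ) : ∏ ν : K →+* ℝ, |ν (e : 𝓞 K)| = 1 := by
  rw [← Finset.abs_prod, ← norm_eq_prod_realEmbeddings]
  have h := (NumberField.isUnit_iff_norm (x := (e : 𝓞 K))).mp e.isUnit
  rw [RingOfIntegers.coe_norm] at h
  exact_mod_cast h

/-- Dirichlet's construction makes the unit small away from `μ`; as the product of its absolute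
values is `1`, it is large at `μ` as soon as another place exists. -/
theorem exists_unit_gt_one_at (μ : K →+* ℝ) :
    ∃ e : (𝓞 K)ˣ, ∀ ν : K →+* ℝ, ν ≠ μ → 1 < |μ (e : 𝓞 K)| ∧ |ν (e : 𝓞 K)| < 1 := by
  obtain ⟨e, he⟩ := Units.dirichletUnitTheorem.exists_unit K
    (InfinitePlace.mk (Complex.ofRealHom.comp μ))
  have hlt : ∀ ν : K →+* ℝ, ν ≠ μ → |ν (e : 𝓞 K)| < 1 := by
    intro ν hν
    have h1 := he (InfinitePlace.mk (Complex.ofRealHom.comp ν))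
      fun h => hν (mk_ofReal_comp_injective h)
    rw [mk_ofReal_comp_apply] at h1
    have hpos : 0 < |ν (e : 𝓞 K)| := abs_pos.mpr (map_ne_zero_of_ne_zero ν e.ne_zero)
    exact (Real.log_neg_iff hpos).mp h1
  refine ⟨e, fun ν hν => ⟨?_, hlt ν hν⟩⟩
  by_contra hμ
  have hle : ∀ τ : K →+* ℝ, |τ (e : 𝓞 K)| ≤ 1 := by
    intro τ
    by_cases h : τ = μ
    · rw [h]; exact not_lt.mp hμ
    · exact (hlt τ h).le
  have := Finset.prod_lt_prod (s := Finset.univ) (f := fun τ : K →+* ℝ => |τ (e : 𝓞 K)|)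
    (g := fun _ => (1 : ℝ)) (fun τ _ => abs_pos.mpr (map_ne_zero_of_ne_zero τ e.ne_zero))
    (fun τ _ => hle τ) ⟨ν, Finset.mem_univ _, hlt ν hν⟩
  rw [prod_abs_unit] at this
  simp at this

omit [NumberField K] [IsTotallyReal K] in
theorem isTotPos_mul_sq {h : K} (hh : IsTotPos h) {y : 𝓞 K} (hy : y ≠ 0) :
    IsTotPos (h * (y : K) ^ 2) :=
  hh.mul (isTotPos_sq (by simpa using hy))

theorem IsTotPos.trace_pos {a : K} (ha : IsTotPos a) : 0 < Algebra.trace ℚ K a := by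
  have : (0 : ℝ) < (Algebra.trace ℚ K a : ℚ) := by
    rw [trace_eq_sum_realEmbeddings]
    exact Finset.sum_pos (fun ν _ => ha ν) Finset.univ_nonempty
  exact_mod_cast this

theorem exists_isTraceMinimizer {h : 𝓞 K} (hh : IsTotPos (h : K)) :
    ∃ y₀ : 𝓞 K, IsTraceMinimizer h y₀ := by
  let f : {y : 𝓞 K // y ≠ 0} → ℕ := fun y => (Algebra.trace ℤ (𝓞 K) (h * y.1 ^ 2)).toNat
  have hf : ∀ y : {y : 𝓞 K // y ≠ 0},
      Algebra.trace ℚ K ((h : K) * (y.1 : K) ^ 2) = (f y : ℚ) := by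
    intro y
    have e : (h : K) * (y.1 : K) ^ 2 = ((h * y.1 ^ 2 : 𝓞 K) : K) := by simp
    have hpos := (isTotPos_mul_sq hh y.2).trace_pos
    rw [e, ← Algebra.coe_trace_int] at hpos ⊢
    have h0 : 0 < Algebra.trace ℤ (𝓞 K) (h * y.1 ^ 2) := by exact_mod_cast hpos
    have := Int.toNat_of_nonneg h0.le
    simp only [f]
    exact_mod_cast this.symm
  have : Nonempty {y : 𝓞 K // y ≠ 0} := ⟨⟨1, one_ne_zero⟩⟩
  refine ⟨(Function.argmin f).1, (Function.argmin f).2, fun y hy => ?_⟩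
  rw [hf (Function.argmin f), hf ⟨y, hy⟩]
  exact_mod_cast Function.argmin_le f ⟨y, hy⟩

/-- Minkowski gives some `y` with all conjugates of `h y²` at most `t`, where `t ^ d = σ_1 N(h)`. So
the minimal trace is at most `d t`, which bounds every conjugate of `h y₀²`; taking norms, `N(h)`
cancels. -/
theorem abs_norm_traceMinimizer_le {h y₀ : 𝓞 K} (hh : IsTotPos (h : K))
    (hy : IsTraceMinimizer h y₀) :
    ((|Algebra.norm ℚ (y₀ : K)| : ℚ) : ℝ) ≤
      (Module.finrank ℚ K : ℝ) ^ Module.finrank ℚ K * sigmaConst K 1 := by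
  set d := Module.finrank ℚ K with hd
  have hd0 : 0 < d := Module.finrank_pos
  set Nh : ℝ := ((Algebra.norm ℚ (h : K) : ℚ) : ℝ) with hNh
  have hNpos : 0 < Nh := Rat.cast_pos.mpr hh.norm_pos
  have hσ := sigmaConst_pos K 1
  set t : ℝ := (sigmaConst K 1 * Nh) ^ ((d : ℝ)⁻¹) with ht
  have ht0 : 0 ≤ t := by positivity
  have htd : t ^ d = sigmaConst K 1 * Nh :=
    Real.rpow_inv_natCast_pow (by positivity) hd0.ne'
  obtain ⟨y, hy0, hyt⟩ := exists_diagValue_le (ι := Unit) (fun _ => (h : K)) (fun _ => hh) 1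
    Matrix.det_one t ht0 (by
      rw [← hd, htd]
      simp [hNh])
  have hyu : y () ≠ 0 := fun h0 => hy0 (by ext1 i; exact h0)
  have hyt' : ∀ ν : K →+* ℝ, ν ((h : K) * (y () : K) ^ 2) ≤ t := by
    intro ν
    simpa [diagValue] using hyt ν
  have htr : ((Algebra.trace ℚ K ((h : K) * (y₀ : K) ^ 2) : ℚ) : ℝ) ≤ d * t := by
    have h1 : ((Algebra.trace ℚ K ((h : K) * (y₀ : K) ^ 2) : ℚ) : ℝ)
        ≤ ((Algebra.trace ℚ K ((h : K) * (y () : K) ^ 2) : ℚ) : ℝ) := by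
      exact_mod_cast hy.2 _ hyu
    refine h1.trans ?_
    rw [trace_eq_sum_realEmbeddings]
    refine (Finset.sum_le_card_nsmul _ _ t fun ν _ => hyt' ν).trans ?_
    rw [Finset.card_univ, card_realEmbeddings, nsmul_eq_mul]
  have hpos := isTotPos_mul_sq hh hy.1
  have hle : ∀ ν : K →+* ℝ, ν ((h : K) * (y₀ : K) ^ 2) ≤ d * t := by
    intro ν
    refine le_trans ?_ htr
    rw [trace_eq_sum_realEmbeddings]
    exact Finset.single_le_sum (fun τ _ => (hpos τ).le) (Finset.mem_univ ν)
  have hN : Nh * ((Algebra.norm ℚ ((y₀ : K) ^ 2) : ℚ) : ℝ) ≤ (d * t) ^ d := by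
    have h1 : Nh * ((Algebra.norm ℚ ((y₀ : K) ^ 2) : ℚ) : ℝ)
        = ((Algebra.norm ℚ ((h : K) * (y₀ : K) ^ 2) : ℚ) : ℝ) := by
      rw [map_mul, Rat.cast_mul]
    rw [h1, norm_eq_prod_realEmbeddings]
    refine (Finset.prod_le_prod (fun ν _ => (hpos ν).le) fun ν _ => hle ν).trans ?_
    rw [Finset.prod_const, Finset.card_univ, card_realEmbeddings]
  rw [mul_pow, htd] at hN
  have hN' : ((Algebra.norm ℚ ((y₀ : K) ^ 2) : ℚ) : ℝ) ≤ (d : ℝ) ^ d * sigmaConst K 1 := by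
    refine le_of_mul_le_mul_left (hN.trans (le_of_eq ?_)) hNpos
    ring
  refine le_trans ?_ hN'
  have h1 := one_le_abs_norm hy.1
  rw [map_pow, ← sq_abs]
  exact_mod_cast le_self_pow₀ h1 two_ne_zero

-- Finitely many ideals have bounded norm, and one generator is chosen for each principal one among
-- them.
variable (K) in
theorem exists_finset_traceMinimizers :
    ∃ Y : Finset (𝓞 K), (∀ y ∈ Y, y ≠ 0) ∧
      ∀ h : 𝓞 K, IsTotPos (h : K) → ∃ y₀ : 𝓞 K, IsTraceMinimizer h y₀ ∧
        ∃ y ∈ Y, Associated y₀ y := by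
  classical
  set B : ℕ := ⌊(Module.finrank ℚ K : ℝ) ^ Module.finrank ℚ K * sigmaConst K 1⌋₊
  have hfin := Ideal.finite_setOfPred_absNorm_le (S := 𝓞 K) B
  let g : Ideal (𝓞 K) → 𝓞 K := fun I =>
    -- The default `1` keeps zero out of the chosen set.
    if hI : ∃ y : 𝓞 K, y ≠ 0 ∧ I = Ideal.span {y} then hI.choose else 1
  refine ⟨hfin.toFinset.image g, ?_, fun h hh => ?_⟩
  · intro y hy
    obtain ⟨I, -, rfl⟩ := Finset.mem_image.mp hy
    by_cases hI : ∃ y : 𝓞 K, y ≠ 0 ∧ I = Ideal.span {y}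
    · simp only [g, dif_pos hI]
      exact hI.choose_spec.1
    · simp only [g, dif_neg hI]
      exact one_ne_zero
  · obtain ⟨y₀, hy₀⟩ := exists_isTraceMinimizer hh
    have hI : ∃ y : 𝓞 K, y ≠ 0 ∧ Ideal.span {y₀} = Ideal.span {y} := ⟨y₀, hy₀.1, rfl⟩
    refine ⟨y₀, hy₀, g (Ideal.span {y₀}), Finset.mem_image_of_mem _ ?_, ?_⟩
    · rw [Set.Finite.mem_toFinset, Set.mem_ofPred_eq, Ideal.absNorm_span_singleton]
      refine Nat.le_floor ?_
      refine le_trans (le_of_eq ?_) (abs_norm_traceMinimizer_le hh hy₀)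
      rw [← Algebra.coe_norm_int, ← Int.cast_abs, Nat.cast_natAbs]
      push_cast
      rfl
    · simp only [g, dif_pos hI]
      exact Ideal.span_singleton_eq_span_singleton.mp hI.choose_spec.2

variable (K) in
theorem exists_isReductionConstant : ∃ lam : ℝ, IsReductionConstant K lam := by
  choose ε hε using exists_unit_gt_one_at (K := K)
  obtain ⟨Y, hY0, hY⟩ := exists_finset_traceMinimizers K
  obtain ⟨ν₀⟩ := (inferInstance : Nonempty (K →+* ℝ))
  have hYne : Y.Nonempty := by
    obtain ⟨-, -, y, hy, -⟩ := hY 1 fun ν => by simp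
    exact ⟨y, hy⟩
  obtain ⟨C, hC⟩ := exists_isGreatest_of_finite
    (s := insert 1 {r : ℝ | ∃ μ ν : K →+* ℝ, ν ≠ μ ∧
      r = (|μ (ε μ : 𝓞 K)| ^ 2 - 1) / (1 - |ν (ε μ : 𝓞 K)| ^ 2)})
    (Set.Finite.insert _ (Set.Finite.subset (Set.finite_range fun p : (K →+* ℝ) × (K →+* ℝ) =>
      (|p.1 (ε p.1 : 𝓞 K)| ^ 2 - 1) / (1 - |p.2 (ε p.1 : 𝓞 K)| ^ 2))
      (by rintro r ⟨μ, ν, -, rfl⟩; exact ⟨(μ, ν), rfl⟩)))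
    (Set.insert_nonempty _ _)
  obtain ⟨R, hR⟩ := exists_isGreatest_of_finite
    (s := {r : ℝ | ∃ y ∈ Y, ∃ μ ν : K →+* ℝ, r = |ν (y : K)| / |μ (y : K)|})
    (Set.Finite.subset (Set.finite_range fun p : Y × (K →+* ℝ) × (K →+* ℝ) =>
      |p.2.2 (p.1.1 : K)| / |p.2.1 (p.1.1 : K)|)
      (by rintro r ⟨y, hy, μ, ν, rfl⟩; exact ⟨(⟨y, hy⟩, μ, ν), rfl⟩))
    (by obtain ⟨y, hy⟩ := hYne; exact ⟨_, y, hy, ν₀, ν₀, rfl⟩)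
  exact ⟨C * R ^ 2, ε, Y, C, R, hε, hC, hY0, hY, hR, rfl⟩

end ReductionConstant

/-! ### The superdiagonal filtration and exponentials of nilpotent matrices. -/

section Triangular

variable {R : Type*} [CommRing R] {n : ℕ}

/-- Matrices whose entries vanish below the `m`-th superdiagonal. -/
def VanishesBelow (m : ℕ) (A : Matrix (Fin n) (Fin n) R) : Prop :=
  ∀ i j : Fin n, (j : ℕ) < i + m → A i j = 0

namespace VanishesBelow

variable {a b m : ℕ} {A B : Matrix (Fin n) (Fin n) R}

theorem zero : VanishesBelow m (0 : Matrix (Fin n) (Fin n) R) := fun _ _ _ => rfl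

theorem one : VanishesBelow 0 (1 : Matrix (Fin n) (Fin n) R) := by
  intro i j h
  refine Matrix.one_apply_ne ?_
  rintro rfl
  omega

theorem mono (hA : VanishesBelow a A) (h : b ≤ a) : VanishesBelow b A :=
  fun i j hij => hA i j (by omega)

theorem add (hA : VanishesBelow a A) (hB : VanishesBelow a B) : VanishesBelow a (A + B) :=
  fun i j h => by rw [Matrix.add_apply, hA i j h, hB i j h, add_zero]

theorem neg (hA : VanishesBelow a A) : VanishesBelow a (-A) :=
  fun i j h => by rw [Matrix.neg_apply, hA i j h, neg_zero]

theorem sub (hA : VanishesBelow a A) (hB : VanishesBelow a B) : VanishesBelow a (A - B) := by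
  rw [sub_eq_add_neg]
  exact hA.add hB.neg

theorem mul (hA : VanishesBelow a A) (hB : VanishesBelow b B) :
    VanishesBelow (a + b) (A * B) := by
  intro i j h
  rw [Matrix.mul_apply]
  refine Finset.sum_eq_zero fun l _ => ?_
  by_cases hl : (l : ℕ) < i + a
  · rw [hA i l hl, zero_mul]
  · rw [hB l j (by omega), mul_zero]

theorem sum {ι : Type*} (s : Finset ι) {f : ι → Matrix (Fin n) (Fin n) R}
    (h : ∀ k ∈ s, VanishesBelow a (f k)) : VanishesBelow a (∑ k ∈ s, f k) := by
  intro i j hij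
  rw [Matrix.sum_apply]
  exact Finset.sum_eq_zero fun k hk => h k hk i j hij

theorem pow (hA : VanishesBelow 1 A) (k : ℕ) : VanishesBelow k (A ^ k) := by
  induction k with
  | zero => exact one
  | succ k ih =>
    rw [pow_succ]
    exact ih.mul hA

theorem eq_zero (hA : VanishesBelow a A) (h : n ≤ a) : A = 0 := by
  ext i j
  exact hA i j (by omega)

theorem pow_eq_zero (hA : VanishesBelow 1 A) {k : ℕ} (h : n ≤ k) : A ^ k = 0 :=
  (hA.pow k).eq_zero h

theorem isNilpotent (hA : VanishesBelow 1 A) : IsNilpotent A := ⟨n, hA.pow_eq_zero le_rfl⟩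

theorem unipotent_mul (hA : VanishesBelow 1 (A - 1)) (hB : VanishesBelow 1 (B - 1)) :
    VanishesBelow 1 (A * B - 1) := by
  have e : A * B - 1 = (A - 1) * (B - 1) + (A - 1) + (B - 1) := by noncomm_ring
  rw [e]
  exact (((hA.mul hB).mono (by omega)).add hA).add hB

/-- Every word in the expanded difference contains a factor `B`, and each of the other `k` factors
gains one superdiagonal. -/
theorem add_pow_sub_pow (hA : VanishesBelow 1 A) (hB : VanishesBelow m B) (hm : 1 ≤ m) (k : ℕ) :
    VanishesBelow (m + k) ((A + B) ^ (k + 1) - A ^ (k + 1)) := by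
  induction k with
  | zero => simpa using hB
  | succ k ih =>
    have e : (A + B) ^ (k + 1 + 1) - A ^ (k + 1 + 1)
        = ((A + B) ^ (k + 1) - A ^ (k + 1)) * (A + B) + A ^ (k + 1) * B := by
      rw [pow_succ _ (k + 1), pow_succ _ (k + 1)]
      noncomm_ring
    rw [e]
    refine (ih.mul (hA.add (hB.mono hm))).add (((hA.pow (k + 1)).mul hB).mono (by omega))

theorem det_eq_one (hA : VanishesBelow 1 (A - 1)) : A.det = 1 := by
  have hoff : ∀ i j : Fin n, j < i → A i j = 0 := by
    intro i j hij
    have := hA i j (by have := Fin.lt_def.mp hij; omega)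
    rwa [Matrix.sub_apply, Matrix.one_apply_ne (ne_of_gt hij), sub_zero] at this
  have hdiag : ∀ i, A i i = 1 := by
    intro i
    have := hA i i (by omega)
    rwa [Matrix.sub_apply, Matrix.one_apply_eq, sub_eq_zero] at this
  rw [Matrix.det_of_isUpperTriangular fun i j hij => hoff i j hij]
  simp [hdiag]

end VanishesBelow

theorem vanishesBelow_map {S : Type*} [CommRing S] (f : R →+* S) {m : ℕ}
    {A : Matrix (Fin n) (Fin n) R} (hA : VanishesBelow m A) : VanishesBelow m (A.map f) :=
  fun i j h => by rw [Matrix.map_apply, hA i j h, map_zero]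

theorem VanishesBelow.smul_rat [Algebra ℚ R] {m : ℕ} {A : Matrix (Fin n) (Fin n) R}
    (hA : VanishesBelow m A) (q : ℚ) : VanishesBelow m (q • A) :=
  fun i j h => by rw [Matrix.smul_apply, hA i j h, smul_zero]

theorem exp_sub_one_vanishesBelow [Algebra ℚ R] {N : Matrix (Fin n) (Fin n) R}
    (hN : VanishesBelow 1 N) : VanishesBelow 1 (IsNilpotent.exp N - 1) := by
  rw [IsNilpotent.exp_eq_sum (hN.pow_eq_zero (k := n + 1) (by omega)), Finset.sum_range_succ']
  simp only [pow_zero, Nat.factorial_zero, Nat.cast_one, inv_one, one_smul, add_sub_cancel_right]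
  exact VanishesBelow.sum _ fun k _ => ((hN.pow (k + 1)).mono (by omega)).smul_rat _

/-- To first order, perturbing the exponent by `H` perturbs the exponential by `H`: in degree at
least two, `H` is always multiplied by a strictly triangular factor. -/
theorem exp_add_sub_vanishesBelow [Algebra ℚ R] {N H : Matrix (Fin n) (Fin n) R} {m : ℕ}
    (hm : 1 ≤ m) (hN : VanishesBelow 1 N) (hH : VanishesBelow m H) :
    VanishesBelow (m + 1) (IsNilpotent.exp (N + H) - IsNilpotent.exp N - H) := by
  have hNH : VanishesBelow 1 (N + H) := hN.add (hH.mono hm)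
  -- Truncating at `n + 2` ensures that the terms of degree 0 and 1 are there to be split off, even
  -- for `n = 0`.
  rw [IsNilpotent.exp_eq_sum (hN.pow_eq_zero (k := n + 1 + 1) (by omega)),
    IsNilpotent.exp_eq_sum (hNH.pow_eq_zero (k := n + 1 + 1) (by omega)),
    ← Finset.sum_sub_distrib, Finset.sum_range_succ', Finset.sum_range_succ']
  have e : ∀ k : ℕ, (k.factorial : ℚ)⁻¹ • (N + H) ^ k - (k.factorial : ℚ)⁻¹ • N ^ k
      = (k.factorial : ℚ)⁻¹ • ((N + H) ^ k - N ^ k) := fun k => (smul_sub _ _ _).symm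
  simp only [e]
  have e2 : ∀ S : Matrix (Fin n) (Fin n) R,
      S + ((0 + 1).factorial : ℚ)⁻¹ • ((N + H) ^ (0 + 1) - N ^ (0 + 1)) +
        ((0 : ℕ).factorial : ℚ)⁻¹ • ((N + H) ^ 0 - N ^ 0) - H = S := by
    intro S
    simp
  rw [e2]
  exact VanishesBelow.sum _ fun k _ =>
    ((hN.add_pow_sub_pow hH hm (k + 1)).mono (by omega)).smul_rat _

end Triangular

/-! ### The covering constant and integral reduction of unipotent matrices. -/

section Covering

variable {K : Type u} [Field K] [NumberField K] [IsTotallyReal K]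

-- Rounding down the coordinates in an integral basis. This makes the infimum defining `β` one over
-- a nonempty set.
variable (K) in
theorem exists_covering_radius : ∃ r : ℝ, 0 < r ∧
    ∀ x : (K →+* ℝ) → ℝ, ∃ a : 𝓞 K, ∀ ν : K →+* ℝ, |x ν - ν (a : K)| < r := by
  classical
  obtain ⟨b⟩ := exists_integralBasis_indexed (K := K)
  set M : Matrix (K →+* ℝ) (K →+* ℝ) ℝ := Matrix.of fun p ν => ν (b p : K) with hM
  have hM0 : IsUnit M.det := by
    rw [isUnit_iff_ne_zero]
    intro h0
    have h1 := one_le_abs_discr K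
    rw [← det_sq_eq_discr b, ← hM, h0] at h1
    norm_num at h1
  refine ⟨1 + ∑ ν : K →+* ℝ, ∑ p : K →+* ℝ, |ν (b p : K)|, by positivity, fun x => ?_⟩
  set c : (K →+* ℝ) → ℝ := x ᵥ* M⁻¹ with hc
  have hcM : c ᵥ* M = x := by
    rw [hc, Matrix.vecMul_vecMul, Matrix.nonsing_inv_mul _ hM0, Matrix.vecMul_one]
  refine ⟨∑ p, ⌊c p⌋ • b p, fun ν => ?_⟩
  have e : x ν - ν ((∑ p, ⌊c p⌋ • b p : 𝓞 K) : K) = ∑ p, Int.fract (c p) * ν (b p : K) := by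
    have h1 : x ν = ∑ p, c p * ν (b p : K) := by
      rw [← hcM]
      rfl
    rw [h1]
    simp only [map_sum, zsmul_eq_mul, map_mul, map_intCast]
    rw [← Finset.sum_sub_distrib]
    refine Finset.sum_congr rfl fun p _ => ?_
    rw [Int.fract]
    ring
  rw [e]
  have h2 : |∑ p, Int.fract (c p) * ν (b p : K)| ≤ ∑ p : K →+* ℝ, |ν (b p : K)| := by
    refine (Finset.abs_sum_le_sum_abs _ _).trans (Finset.sum_le_sum fun p _ => ?_)
    rw [abs_mul, Int.abs_fract]
    exact mul_le_of_le_one_left (abs_nonneg _) (Int.fract_lt_one _).le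
  have h3 : ∑ p : K →+* ℝ, |ν (b p : K)| ≤ ∑ ν : K →+* ℝ, ∑ p : K →+* ℝ, |ν (b p : K)| :=
    Finset.single_le_sum (f := fun ν : K →+* ℝ => ∑ p : K →+* ℝ, |ν (b p : K)|)
      (fun τ _ => by positivity) (Finset.mem_univ ν)
  linarith

omit [NumberField K] [IsTotallyReal K] in
theorem beta_nonneg : 0 ≤ beta K := Real.sInf_nonneg fun _ hr => hr.1.le

/-- For a fixed `α` only finitely many integers have all conjugates of `α + a` bounded by `β + 1`,
so a translate of least sup norm exists and meets the bound `β` itself. -/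
theorem exists_add_le_beta (α : K) : ∃ a : 𝓞 K, ∀ ν : K →+* ℝ, |ν (α + (a : K))| ≤ beta K := by
  set S := {r : ℝ | 0 < r ∧
    ∀ x : (K →+* ℝ) → ℝ, ∃ a : 𝓞 K, ∀ ν : K →+* ℝ, |x ν - ν (a : K)| < r} with hS
  have hSne : S.Nonempty := exists_covering_radius K
  have happrox : ∀ e : ℝ, 0 < e → ∃ a : 𝓞 K, ∀ ν : K →+* ℝ, |ν (α + (a : K))| < beta K + e := by
    intro e he
    obtain ⟨r, hr, hlt⟩ := exists_lt_of_csInf_lt hSne (show sInf S < beta K + e by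
      rw [beta]; linarith)
    obtain ⟨a, ha⟩ := hr.2 fun ν => ν α
    refine ⟨-a, fun ν => ?_⟩
    have := (ha ν).trans hlt
    simpa [sub_eq_add_neg] using this
  set F := {a : 𝓞 K | ∀ ν : K →+* ℝ, |ν (α + (a : K))| ≤ beta K + 1} with hF
  have hFfin : F.Finite := by
    set B := ∑ ν : K →+* ℝ, |ν α| with hB
    refine Set.Finite.of_finite_image (f := fun a : 𝓞 K => (a : K)) ?_
      RingOfIntegers.coe_injective.injOn
    refine (Embeddings.finite_of_norm_le K ℂ (beta K + 1 + B)).subset ?_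
    rintro _ ⟨a, ha, rfl⟩
    refine ⟨a.isIntegral_coe, fun φ => ?_⟩
    obtain ⟨ν, rfl⟩ := exists_real_embedding φ
    have h1 := ha ν
    have h2 : |ν α| ≤ B := Finset.single_le_sum (f := fun ν : K →+* ℝ => |ν α|)
      (fun _ _ => abs_nonneg _) (Finset.mem_univ ν)
    have h3 : ν (a : K) = ν (α + (a : K)) - ν α := by rw [map_add]; ring
    simp only [RingHom.comp_apply, Complex.ofRealHom_eq_coe, Complex.norm_real, Real.norm_eq_abs]
    rw [h3]
    exact (abs_sub _ _).trans (add_le_add h1 h2)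
  obtain ⟨a₀, ha₀⟩ := happrox 1 one_pos
  obtain ⟨a, -, hmin⟩ := Set.exists_min_image F
    (fun a : 𝓞 K => ‖fun ν : K →+* ℝ => ν (α + (a : K))‖) hFfin ⟨a₀, fun ν => (ha₀ ν).le⟩
  refine ⟨a, fun ν => ?_⟩
  refine (norm_le_pi_norm (fun ν : K →+* ℝ => ν (α + (a : K))) ν).trans ?_
  refine le_of_forall_pos_le_add fun e he => ?_
  obtain ⟨a', ha'⟩ := happrox (min e 1) (lt_min he one_pos)
  have hβ := beta_nonneg (K := K)
  refine (hmin a' fun ν => (ha' ν).le.trans (by have := min_le_right e 1; linarith)).trans ?_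
  rw [pi_norm_le_iff_of_nonneg (by linarith)]
  intro ν
  exact (ha' ν).le.trans (by have := min_le_left e 1; linarith)

/-- `T` and `N` are built one superdiagonal at a time. Both a factor `1 + t` in `T` and a summand
`H` in `N` act additively on the first superdiagonal where `U T` and `exp N` differ, so the
discrepancy there can be shifted by integers to size at most `β` and then absorbed into `N`. -/
theorem exists_mul_eq_exp {n : ℕ} (U : Matrix (Fin n) (Fin n) K) (hU : VanishesBelow 1 (U - 1)) :
    ∃ (T : Matrix (Fin n) (Fin n) (𝓞 K)) (N : Matrix (Fin n) (Fin n) K),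
      VanishesBelow 1 (T - 1) ∧ VanishesBelow 1 N ∧
      (∀ i j (ν : K →+* ℝ), |ν (N i j)| ≤ beta K) ∧
      U * T.map (algebraMap (𝓞 K) K) = IsNilpotent.exp N := by
  have hβ := beta_nonneg (K := K)
  have key : ∀ m : ℕ, ∃ (T : Matrix (Fin n) (Fin n) (𝓞 K)) (N : Matrix (Fin n) (Fin n) K),
      VanishesBelow 1 (T - 1) ∧ VanishesBelow 1 N ∧
      (∀ i j (ν : K →+* ℝ), |ν (N i j)| ≤ beta K) ∧
      -- `N` is still zero on the superdiagonals to come, so adding `H` fills empty places and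
      -- preserves the bound `β`.
      (∀ i j : Fin n, (i : ℕ) + (m + 1) ≤ j → N i j = 0) ∧
      VanishesBelow (m + 1) (U * T.map (algebraMap (𝓞 K) K) - IsNilpotent.exp N) := by
    intro m
    induction m with
    | zero =>
      refine ⟨1, 0, ?_, VanishesBelow.zero, ?_, fun _ _ _ => rfl, ?_⟩
      · rw [sub_self]; exact VanishesBelow.zero
      · intro i j ν
        simpa using hβ
      · rw [IsNilpotent.exp_zero, Matrix.map_one _ (map_zero _) (map_one _), mul_one]
        exact hU
    | succ m ih =>
      obtain ⟨T, N, hT, hN, hNβ, hN0, hD⟩ := ih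
      set φ := algebraMap (𝓞 K) K
      set D := U * T.map φ - IsNilpotent.exp N with hDdef
      choose τ hτ using fun i j => exists_add_le_beta (D i j)
      set t : Matrix (Fin n) (Fin n) (𝓞 K) :=
        Matrix.of fun i j => if (j : ℕ) = i + (m + 1) then τ i j else 0 with ht
      set H : Matrix (Fin n) (Fin n) K :=
        Matrix.of fun i j => if (j : ℕ) = i + (m + 1) then D i j + τ i j else 0 with hH
      have ht' : VanishesBelow (m + 1) t := fun i j h => by
        rw [ht, Matrix.of_apply, if_neg (by omega)]
      have hH' : VanishesBelow (m + 1) H := fun i j h => by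
        rw [hH, Matrix.of_apply, if_neg (by omega)]
      have hTφ : VanishesBelow 1 (T.map φ - 1) := by
        have := vanishesBelow_map φ hT
        rwa [Matrix.map_sub _ (map_sub φ), Matrix.map_one _ (map_zero _) (map_one _)] at this
      have hUT := hU.unipotent_mul hTφ
      refine ⟨T * (1 + t), N + H, hT.unipotent_mul ?_, hN.add (hH'.mono (by omega)), ?_, ?_, ?_⟩
      · rw [add_sub_cancel_left]
        exact ht'.mono (by omega)
      · intro i j ν
        rw [Matrix.add_apply]
        by_cases h : (j : ℕ) = i + (m + 1)
        · rw [hN0 i j h.ge, zero_add, hH, Matrix.of_apply, if_pos h]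
          exact hτ i j ν
        · rw [hH, Matrix.of_apply, if_neg h, add_zero]
          exact hNβ i j ν
      · intro i j h
        rw [Matrix.add_apply, hN0 i j (by omega), zero_add, hH, Matrix.of_apply,
          if_neg (by omega)]
      -- The first bracket vanishes on superdiagonal `m + 1` by the choice of `H`; the other two
      -- terms start strictly above it.
      · have e : U * (T * (1 + t)).map φ - IsNilpotent.exp (N + H)
            = (D + t.map φ - H) + (U * T.map φ - 1) * t.map φ
              - (IsNilpotent.exp (N + H) - IsNilpotent.exp N - H) := by
          have h1 : (T * (1 + t)).map φ = T.map φ * (1 + t.map φ) := by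
            rw [Matrix.map_mul, Matrix.map_add _ (map_add φ),
              Matrix.map_one _ (map_zero _) (map_one _)]
          rw [h1, hDdef]
          noncomm_ring
        rw [e]
        have htφ := vanishesBelow_map φ ht'
        refine VanishesBelow.sub (VanishesBelow.add ?_ ?_)
          (exp_add_sub_vanishesBelow (by omega) hN hH')
        · intro i j h
          rw [Matrix.sub_apply, Matrix.add_apply]
          by_cases hij : (j : ℕ) = i + (m + 1)
          · rw [hH, Matrix.of_apply, if_pos hij, Matrix.map_apply, ht, Matrix.of_apply,
              if_pos hij, sub_self]
          · rw [hD i j (by omega), htφ i j (by omega), hH' i j (by omega)]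
            simp
        · exact (hUT.mul htφ).mono (by omega)
  obtain ⟨T, N, hT, hN, hNβ, -, hD⟩ := key n
  exact ⟨T, N, hT, hN, hNβ, sub_eq_zero.mp (hD.eq_zero (by omega))⟩

end Covering

/-! ### Majorization of matrix exponentials by a power series. -/

section Domination

open PowerSeries

variable (K : Type u) [Field K]

/-- The power series `β x / (1 - x)`. -/
def betaSeries : PowerSeries ℝ := C (beta K) * X * (1 - X : PowerSeries ℝ)⁻¹

theorem one_sub_X_inv : (1 - X : PowerSeries ℝ)⁻¹ = PowerSeries.mk 1 := by
  rw [PowerSeries.inv_eq_iff_mul_eq_one (by simp)]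
  exact PowerSeries.mk_one_mul_one_sub_eq_one ℝ

theorem coeff_betaSeries (m : ℕ) : coeff m (betaSeries K) = if m = 0 then 0 else beta K := by
  rw [betaSeries, one_sub_X_inv, mul_assoc, coeff_C_mul]
  cases m with
  | zero => simp
  | succ m => simp [coeff_succ_X_mul]

theorem coeff_betaSeries_nonneg (m : ℕ) : 0 ≤ coeff m (betaSeries K) := by
  rw [coeff_betaSeries]
  split_ifs
  · exact le_rfl
  · exact Real.sInf_nonneg fun _ hr => hr.1.le

theorem coeff_betaSeries_pow_nonneg (k m : ℕ) : 0 ≤ coeff m (betaSeries K ^ k) := by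
  induction k generalizing m with
  | zero =>
    rw [pow_zero, coeff_one]
    split_ifs <;> norm_num
  | succ k ih =>
    rw [pow_succ, coeff_mul]
    exact Finset.sum_nonneg fun p _ => mul_nonneg (ih _) (coeff_betaSeries_nonneg K _)

theorem coeff_betaSeries_pow_eq_zero {k m : ℕ} (h : m < k) : coeff m (betaSeries K ^ k) = 0 := by
  have e : betaSeries K ^ k = X ^ k * (C (beta K) * (1 - X : PowerSeries ℝ)⁻¹) ^ k := by
    rw [betaSeries, ← mul_pow]
    ring
  rw [e, coeff_X_pow_mul', if_neg (by omega)]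

/-- `β x / (1 - x)` has no constant term, so its `k`-th power does not reach degree `m` once `k >
m`. -/
theorem cCoeff_eq_sum {m n : ℕ} (h : m < n) :
    cCoeff K m = ∑ k ∈ Finset.range n, (k.factorial : ℝ)⁻¹ * coeff m (betaSeries K ^ k) := by
  have hsub : HasSubst (betaSeries K) := by
    refine HasSubst.of_constantCoeff_zero' ?_
    rw [← coeff_zero_eq_constantCoeff_apply, coeff_betaSeries, if_pos rfl]
  rw [cCoeff, ← betaSeries, coeff_subst' hsub, finsum_eq_sum_of_support_subset (s := Finset.range n)]
  · refine Finset.sum_congr rfl fun k _ => ?_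
    rw [coeff_exp]
    simp
  · intro k hk
    by_contra hkn
    apply hk
    have : n ≤ k := by simpa using hkn
    simp only
    rw [coeff_betaSeries_pow_eq_zero K (by omega), smul_zero]

variable {K}

/-- If entries are bounded by a function of `j - i`, products of triangular matrices are bounded by
Cauchy products. Here `β x / (1 - x) = ∑ β x ^ m`, over `m ≥ 1`, majorizes `N`. -/
theorem abs_pow_apply_le {n : ℕ} {N : Matrix (Fin n) (Fin n) K} (hN : VanishesBelow 1 N)
    (ν : K →+* ℝ) (hβ : ∀ i j, |ν (N i j)| ≤ beta K) (k : ℕ) (i j : Fin n) (hij : i ≤ j) :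
    |ν ((N ^ k) i j)| ≤ coeff ((j : ℕ) - i) (betaSeries K ^ k) := by
  induction k generalizing j with
  | zero =>
    rw [pow_zero, pow_zero, coeff_one]
    by_cases h : i = j
    · subst h
      simp
    · rw [Matrix.one_apply_ne h, map_zero, abs_zero]
      split_ifs <;> norm_num
  | succ k ih =>
    rw [pow_succ, Matrix.mul_apply, pow_succ, coeff_mul, map_sum]
    refine (Finset.abs_sum_le_sum_abs _ _).trans ?_
    set F : ℕ × ℕ → ℝ := fun p => coeff p.1 (betaSeries K ^ k) * coeff p.2 (betaSeries K)
    have hF : ∀ p, 0 ≤ F p := fun p =>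
      mul_nonneg (coeff_betaSeries_pow_nonneg K _ _) (coeff_betaSeries_nonneg K _)
    have h1 : ∑ l, |ν ((N ^ k) i l * N l j)|
        ≤ ∑ l ∈ Finset.Icc i j, F ((l : ℕ) - i, (j : ℕ) - l) := by
      rw [← Finset.sum_subset (Finset.subset_univ (Finset.Icc i j))]
      · refine Finset.sum_le_sum fun l hl => ?_
        obtain ⟨hil, hlj⟩ := Finset.mem_Icc.mp hl
        rw [map_mul, abs_mul]
        refine mul_le_mul (ih l hil) ?_ (abs_nonneg _) (coeff_betaSeries_pow_nonneg K _ _)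
        rw [coeff_betaSeries]
        split_ifs with h0
        · rw [hN l j (by have := Fin.le_def.mp hlj; simp only at h0; omega), map_zero, abs_zero]
        · exact hβ l j
      · intro l _ hl
        rw [Finset.mem_Icc, not_and_or, not_le, not_le] at hl
        rcases hl with hl | hl
        · rw [(hN.pow k) i l (by have := Fin.lt_def.mp hl; omega), zero_mul, map_zero, abs_zero]
        · rw [hN l j (by have := Fin.lt_def.mp hl; omega), mul_zero, map_zero, abs_zero]
    refine h1.trans ?_
    rw [← Finset.sum_image (f := F) (g := fun l : Fin n => ((l : ℕ) - i, (j : ℕ) - l))]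
    · refine Finset.sum_le_sum_of_subset_of_nonneg ?_ fun p _ _ => hF p
      intro p hp
      obtain ⟨l, hl, rfl⟩ := Finset.mem_image.mp hp
      obtain ⟨hil, hlj⟩ := Finset.mem_Icc.mp hl
      rw [Finset.HasAntidiagonal.mem_antidiagonal]
      have := Fin.le_def.mp hil
      have := Fin.le_def.mp hlj
      simp only
      omega
    · intro l hl l' hl' h
      obtain ⟨hil, hlj⟩ := Finset.mem_Icc.mp hl
      obtain ⟨hil', hlj'⟩ := Finset.mem_Icc.mp hl'
      have := Fin.le_def.mp hil
      have := Fin.le_def.mp hil'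
      have h2 := congrArg Prod.fst h
      simp only at h2
      exact Fin.ext (by omega)

/-- The hypothesis involves only absolute values, so it passes to `-N`; this is why one logarithm
controls a matrix and its inverse. -/
theorem inE_exp [CharZero K] {n : ℕ} {N : Matrix (Fin n) (Fin n) K} (hN : VanishesBelow 1 N)
    (hβ : ∀ i j (ν : K →+* ℝ), |ν (N i j)| ≤ beta K) (i j : Fin n) (hij : i < j) :
    InE ((j : ℕ) - i) (IsNilpotent.exp N i j) := by
  intro ν
  rw [cCoeff_eq_sum K (show (j : ℕ) - i < n by omega),
    IsNilpotent.exp_eq_sum (hN.pow_eq_zero le_rfl), Matrix.sum_apply, map_sum]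
  refine (Finset.abs_sum_le_sum_abs _ _).trans (Finset.sum_le_sum fun k _ => ?_)
  rw [Matrix.smul_apply, Rat.smul_def, map_mul, map_ratCast, abs_mul]
  have e : |(((k.factorial : ℚ)⁻¹ : ℚ) : ℝ)| = (k.factorial : ℝ)⁻¹ := by
    push_cast
    exact abs_of_nonneg (by positivity)
  rw [e]
  exact mul_le_mul_of_nonneg_left
    (abs_pow_apply_le hN ν (fun i j => hβ i j ν) k i j hij.le) (by positivity)

end Domination

/-! ### Bordered matrices, completing the square and extending to a basis. -/

section Bordered

variable {R : Type*} [CommRing R] {n : ℕ}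

/-- The block diagonal matrix with blocks `a` and `A`. -/
def diagBlock (a : R) (A : Matrix (Fin n) (Fin n) R) : Matrix (Fin (n + 1)) (Fin (n + 1)) R :=
  Matrix.of (Fin.cons (Fin.cons a 0) fun i => Fin.cons 0 (A i))

/-- The unipotent matrix with first row `(1, r)` that agrees with the identity elsewhere. -/
def rowShear (r : Fin n → R) : Matrix (Fin (n + 1)) (Fin (n + 1)) R :=
  Matrix.of (Fin.cons (Fin.cons 1 r) fun i => Fin.cons 0 ((1 : Matrix (Fin n) (Fin n) R) i))

@[simp] theorem diagBlock_zero_zero (a : R) (A : Matrix (Fin n) (Fin n) R) :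
    diagBlock a A 0 0 = a := rfl
@[simp] theorem diagBlock_zero_succ (a : R) (A : Matrix (Fin n) (Fin n) R) (j : Fin n) :
    diagBlock a A 0 j.succ = 0 := rfl
@[simp] theorem diagBlock_succ_zero (a : R) (A : Matrix (Fin n) (Fin n) R) (i : Fin n) :
    diagBlock a A i.succ 0 = 0 := rfl
@[simp] theorem diagBlock_succ_succ (a : R) (A : Matrix (Fin n) (Fin n) R) (i j : Fin n) :
    diagBlock a A i.succ j.succ = A i j := rfl
@[simp] theorem rowShear_zero_zero (r : Fin n → R) : rowShear r 0 0 = 1 := rfl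
@[simp] theorem rowShear_zero_succ (r : Fin n → R) (j : Fin n) : rowShear r 0 j.succ = r j := rfl
@[simp] theorem rowShear_succ_zero (r : Fin n → R) (i : Fin n) : rowShear r i.succ 0 = 0 := rfl
@[simp] theorem rowShear_succ_succ (r : Fin n → R) (i j : Fin n) :
    rowShear r i.succ j.succ = (1 : Matrix (Fin n) (Fin n) R) i j := rfl

omit [CommRing R] in
theorem ext_succ {A B : Matrix (Fin (n + 1)) (Fin (n + 1)) R} (h00 : A 0 0 = B 0 0)
    (h0 : ∀ j : Fin n, A 0 j.succ = B 0 j.succ) (h1 : ∀ i : Fin n, A i.succ 0 = B i.succ 0)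
    (h2 : ∀ i j : Fin n, A i.succ j.succ = B i.succ j.succ) : A = B := by
  ext i j
  refine Fin.cases ?_ (fun i => ?_) i
  · exact Fin.cases h00 h0 j
  · exact Fin.cases (h1 i) (h2 i) j

theorem diagBlock_mul (a b : R) (A B : Matrix (Fin n) (Fin n) R) :
    diagBlock a A * diagBlock b B = diagBlock (a * b) (A * B) := by
  apply ext_succ <;> intros <;> simp [Matrix.mul_apply, Fin.sum_univ_succ]

theorem diagBlock_one : diagBlock 1 (1 : Matrix (Fin n) (Fin n) R) = 1 := by
  apply ext_succ <;> intros <;> simp [Matrix.one_apply, Fin.succ_ne_zero, (Fin.succ_ne_zero _).symm]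

theorem diagBlock_transpose (a : R) (A : Matrix (Fin n) (Fin n) R) :
    (diagBlock a A)ᵀ = diagBlock a Aᵀ := by
  apply ext_succ <;> intros <;> simp

theorem diagBlock_map {S : Type*} [CommRing S] (f : R →+* S) (A : Matrix (Fin n) (Fin n) R) :
    (diagBlock 1 A).map f = diagBlock 1 (A.map f) := by
  apply ext_succ <;> intros <;> simp

theorem diagBlock_diagonal (a : R) (h : Fin n → R) :
    diagBlock a (Matrix.diagonal h) = Matrix.diagonal (Fin.cons a h : Fin (n + 1) → R) := by
  apply ext_succ <;> intros <;>
    simp [Matrix.diagonal_apply, Fin.succ_ne_zero, (Fin.succ_ne_zero _).symm]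

theorem rowShear_mul_diagBlock (r : Fin n → R) (A : Matrix (Fin n) (Fin n) R) :
    rowShear r * diagBlock 1 A = diagBlock 1 A * rowShear (r ᵥ* A) := by
  apply ext_succ <;> intros <;>
    simp [Matrix.mul_apply, Fin.sum_univ_succ, Matrix.vecMul, dotProduct, Matrix.one_apply]

theorem isUnit_diagBlock {A : Matrix (Fin n) (Fin n) R} (hA : IsUnit A) :
    IsUnit (diagBlock 1 A) := by
  obtain ⟨u, rfl⟩ := hA
  refine ⟨⟨diagBlock 1 (u : Matrix (Fin n) (Fin n) R),
    diagBlock 1 ((u⁻¹ : (Matrix (Fin n) (Fin n) R)ˣ) : Matrix (Fin n) (Fin n) R), ?_, ?_⟩, rfl⟩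
  · rw [diagBlock_mul, Units.mul_inv, one_mul, diagBlock_one]
  · rw [diagBlock_mul, Units.inv_mul, one_mul, diagBlock_one]

theorem dotProduct_congr_mulVec (Q T : Matrix (Fin n) (Fin n) R) (y : Fin n → R) :
    y ⬝ᵥ (Tᵀ * Q * T) *ᵥ y = (T *ᵥ y) ⬝ᵥ Q *ᵥ (T *ᵥ y) := by
  rw [← Matrix.mulVec_mulVec, ← Matrix.mulVec_mulVec, Matrix.dotProduct_mulVec,
    Matrix.vecMul_transpose]

/-- Completion of the square in the first variable. -/
theorem eq_rowShear_transpose_mul {F : Type*} [Field F] (Q : Matrix (Fin (n + 1)) (Fin (n + 1)) F)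
    (hQ : Q.IsSymm) (h0 : Q 0 0 ≠ 0) :
    ∃ (w : Fin n → F) (P : Matrix (Fin n) (Fin n) F), P.IsSymm ∧
      Q = (rowShear w)ᵀ * diagBlock (Q 0 0) P * rowShear w := by
  have hs : ∀ i j, Q i j = Q j i := fun i j => hQ.apply j i
  refine ⟨fun j => Q 0 j.succ / Q 0 0,
    Matrix.of fun i j => Q i.succ j.succ - Q 0 i.succ * Q 0 j.succ / Q 0 0, ?_, ?_⟩
  · ext i j
    simp only [Matrix.transpose_apply, Matrix.of_apply]
    rw [hs i.succ, mul_comm (Q 0 i.succ)]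
  · apply ext_succ
    · simp [Matrix.mul_apply, Fin.sum_univ_succ]
    · intro j
      simp [Matrix.mul_apply, Fin.sum_univ_succ, mul_div_cancel₀ _ h0]
    · intro i
      simp [Matrix.mul_apply, Fin.sum_univ_succ, div_mul_cancel₀ _ h0, hs i.succ 0]
    · intro i j
      simp [Matrix.mul_apply, Fin.sum_univ_succ, Matrix.one_apply, div_mul_cancel₀ _ h0]
      ring

/-- The functional `x ↦ ∑ c i * x i` takes the value `1` at `v`, so the module splits as the line of
`v` plus the kernel, and the kernel is free over a principal ideal domain. -/
theorem exists_isUnit_matrix_with_column {R : Type*} [CommRing R] [IsDomain R]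
    [IsPrincipalIdealRing R] {n : ℕ} (v c : Fin (n + 1) → R) (h : ∑ i, c i * v i = 1) :
    ∃ T : Matrix (Fin (n + 1)) (Fin (n + 1)) R, IsUnit T ∧ ∀ i, T i 0 = v i := by
  let f : (Fin (n + 1) → R) →ₗ[R] R := ∑ i, c i • LinearMap.proj i
  have hf : ∀ x, f x = ∑ i, c i * x i := fun x => by simp [f]
  have hfv : f v = 1 := by rw [hf, h]
  obtain ⟨m, ⟨b⟩⟩ := Submodule.nonempty_basis_of_pid (Pi.basisFun R (Fin (n + 1)))
    (LinearMap.ker f)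
  let B := Module.Basis.mkFinCons v b
    (fun a x hx hax => by
      have := congrArg f hax
      rw [map_add, map_smul, hfv, LinearMap.mem_ker.mp hx] at this
      simpa using this)
    (fun z => ⟨-f z, by
      rw [LinearMap.mem_ker, map_add, map_smul, hfv]
      simp⟩)
  have hcard : m = n := by
    have h1 := Module.finrank_eq_card_basis B
    have h2 := Module.finrank_eq_card_basis (Pi.basisFun R (Fin (n + 1)))
    rw [h1, Fintype.card_fin, Fintype.card_fin] at h2
    omega
  subst hcard
  refine ⟨(Pi.basisFun R (Fin (m + 1))).toMatrix B, ?_, fun i => ?_⟩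
  · have := (Pi.basisFun R (Fin (m + 1))).invertibleToMatrix B
    exact isUnit_of_invertible _
  · rw [Module.Basis.toMatrix_apply, Pi.basisFun_repr]
    have : B 0 = v := by
      simp only [B, Module.Basis.coe_mkFinCons, Fin.cons_zero]
    rw [this]

end Bordered

/-! ### Minimal vectors and the recursive construction of the expansion. -/

section HKZ

variable {K : Type u} [Field K] [NumberField K] [IsTotallyReal K] {n : ℕ}

/-- The values of `Q` at nonzero vectors over `K` are totally positive. -/
def IsTotPosForm (Q : Matrix (Fin n) (Fin n) K) : Prop :=
  Q.IsSymm ∧ ∀ x : Fin n → K, x ≠ 0 → IsTotPos (x ⬝ᵥ Q *ᵥ x)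

omit [NumberField K] [IsTotallyReal K] in
theorem IsTotPosForm.congr {Q : Matrix (Fin n) (Fin n) K} (hQ : IsTotPosForm Q)
    {T : Matrix (Fin n) (Fin n) K} (hT : IsUnit T) : IsTotPosForm (Tᵀ * Q * T) := by
  refine ⟨?_, fun x hx => ?_⟩
  · rw [Matrix.IsSymm, Matrix.transpose_mul, Matrix.transpose_mul, Matrix.transpose_transpose,
      hQ.1.eq, mul_assoc]
  · rw [dotProduct_congr_mulVec]
    refine hQ.2 _ fun h0 => hx ?_
    exact Matrix.mulVec_injective_of_isUnit hT (by rw [h0, Matrix.mulVec_zero])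

omit [NumberField K] [IsTotallyReal K] in
theorem value_eq_dotProduct (Q : Matrix (Fin n) (Fin n) K) (x : Fin n → 𝓞 K) :
    value Q x = (fun i => (x i : K)) ⬝ᵥ Q *ᵥ fun i => (x i : K) := by
  simp only [value, dotProduct, Matrix.mulVec, Finset.mul_sum, mul_assoc]

omit [NumberField K] [IsTotallyReal K] in
theorem value_congr (Q : Matrix (Fin n) (Fin n) K) (T : Matrix (Fin n) (Fin n) (𝓞 K))
    (x : Fin n → 𝓞 K) :
    value ((T.map (algebraMap (𝓞 K) K))ᵀ * Q * T.map (algebraMap (𝓞 K) K)) x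
      = value Q (T *ᵥ x) := by
  rw [value_eq_dotProduct, value_eq_dotProduct, dotProduct_congr_mulVec]
  have : (T.map (algebraMap (𝓞 K) K)) *ᵥ (fun i => (x i : K))
      = fun i => (((T *ᵥ x) i : 𝓞 K) : K) := by
    ext i
    simp [Matrix.mulVec, dotProduct]
  rw [this]

omit [NumberField K] [IsTotallyReal K] in
theorem value_smul (Q : Matrix (Fin n) (Fin n) K) (g : 𝓞 K) (x : Fin n → 𝓞 K) :
    value Q (g • x) = (g : K) ^ 2 * value Q x := by
  simp only [value, Finset.mul_sum, Pi.smul_apply, smul_eq_mul, map_mul]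
  refine Finset.sum_congr rfl fun i _ => Finset.sum_congr rfl fun j _ => ?_
  ring

omit [NumberField K] [IsTotallyReal K] in
theorem coe_ne_zero_of_ne_zero {x : Fin n → 𝓞 K} (hx : x ≠ 0) : (fun i => (x i : K)) ≠ 0 := by
  intro h0
  apply hx
  ext i
  have := congrFun h0 i
  simpa using this

omit [NumberField K] [IsTotallyReal K] in
theorem IsTotPosForm.value_isTotPos {Q : Matrix (Fin n) (Fin n) K} (hQ : IsTotPosForm Q)
    {x : Fin n → 𝓞 K} (hx : x ≠ 0) : IsTotPos (value Q x) := by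
  rw [value_eq_dotProduct]
  exact hQ.2 _ (coe_ne_zero_of_ne_zero hx)

/-- After clearing denominators the norms of the values are positive integers, so a least one
exists. -/
theorem exists_minimal_vector (hn : 0 < n) {Q : Matrix (Fin n) (Fin n) K} (hQ : IsTotPosForm Q) :
    ∃ v : Fin n → 𝓞 K, v ≠ 0 ∧ ∀ x : Fin n → 𝓞 K, x ≠ 0 →
      Algebra.norm ℚ (value Q v) ≤ Algebra.norm ℚ (value Q x) := by
  classical
  obtain ⟨D, hD0, hD⟩ := exists_integral_multiples ℤ ℚ (L := K)
    (Finset.univ.image fun p : Fin n × Fin n => Q p.1 p.2)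
  have hint : ∀ i j, ∃ a : 𝓞 K, (a : K) = (D : K) * Q i j := by
    intro i j
    have := hD (Q i j) (Finset.mem_image.mpr ⟨(i, j), Finset.mem_univ _, rfl⟩)
    rw [zsmul_eq_mul] at this
    exact ⟨⟨_, this⟩, rfl⟩
  choose A hA using hint
  have hDK : (0 : ℚ) < |(D : ℚ)| ^ Module.finrank ℚ K := by
    have : (D : ℚ) ≠ 0 := by exact_mod_cast hD0
    positivity
  let F : (Fin n → 𝓞 K) → 𝓞 K := fun x => ∑ i, ∑ j, x i * A i j * x j
  have hF : ∀ x, (F x : K) = (D : K) * value Q x := by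
    intro x
    simp only [F, value, map_sum, map_mul, Finset.mul_sum, hA]
    refine Finset.sum_congr rfl fun i _ => Finset.sum_congr rfl fun j _ => ?_
    ring
  have hnorm : ∀ x : Fin n → 𝓞 K, x ≠ 0 → ((Algebra.norm ℤ (F x)).natAbs : ℚ)
      = |(D : ℚ)| ^ Module.finrank ℚ K * Algebra.norm ℚ (value Q x) := by
    intro x hx
    rw [Nat.cast_natAbs, Int.cast_abs, Algebra.coe_norm_int, hF, map_mul, abs_mul,
      abs_of_pos (hQ.value_isTotPos hx).norm_pos]
    have : (D : K) = algebraMap ℚ K D := by simp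
    rw [this, Algebra.norm_algebraMap, abs_pow]
  have : Nonempty {x : Fin n → 𝓞 K // x ≠ 0} :=
    ⟨⟨fun _ => 1, fun h => one_ne_zero (congrFun h ⟨0, hn⟩)⟩⟩
  set f : {x : Fin n → 𝓞 K // x ≠ 0} → ℕ := fun x => (Algebra.norm ℤ (F x.1)).natAbs with hf
  refine ⟨(Function.argmin f).1, (Function.argmin f).2, fun x hx => ?_⟩
  have h1 := Function.argmin_le f ⟨x, hx⟩
  have h2 : ((f (Function.argmin f) : ℕ) : ℚ) ≤ f ⟨x, hx⟩ := by exact_mod_cast h1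
  simp only [hf] at h2
  rw [hnorm _ hx, hnorm _ (Function.argmin f).2] at h2
  exact le_of_mul_le_mul_left h2 hDK

/-- Dividing a minimal vector by the gcd `g` of its coordinates divides the norm of the value by
`N(g²) ≥ 1`, so minimality survives. -/
theorem exists_primitive_minimal_vector [IsPrincipalIdealRing (𝓞 K)] (hn : 0 < n)
    {Q : Matrix (Fin n) (Fin n) K} (hQ : IsTotPosForm Q) :
    ∃ v c : Fin n → 𝓞 K, ∑ i, c i * v i = 1 ∧ ∀ x : Fin n → 𝓞 K, x ≠ 0 →
      Algebra.norm ℚ (value Q v) ≤ Algebra.norm ℚ (value Q x) := by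
  obtain ⟨v, hv0, hv⟩ := exists_minimal_vector hn hQ
  obtain ⟨g, hg⟩ := IsPrincipalIdealRing.principal (Ideal.span (Set.range v))
  have hdvd : ∀ i, ∃ w, v i = g * w := by
    intro i
    have : v i ∈ Ideal.span {g} := by
      rw [Ideal.submodule_span_eq] at hg
      rw [← hg]
      exact Ideal.subset_span ⟨i, rfl⟩
    exact Ideal.mem_span_singleton.mp this
  choose w hw using hdvd
  have hvw : v = g • w := by
    ext1 i
    exact hw i
  have hg0 : g ≠ 0 := by
    rintro rfl
    apply hv0
    rw [hvw, zero_smul]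
  have hgm : g ∈ Ideal.span (Set.range v) := by
    rw [hg]
    exact Submodule.mem_span_singleton_self g
  obtain ⟨c, hc⟩ := Ideal.mem_span_range_iff_exists_fun.mp hgm
  have hc1 : ∑ i, c i * w i = 1 := by
    refine mul_left_cancel₀ hg0 ?_
    rw [mul_one, Finset.mul_sum]
    nth_rewrite 2 [← hc]
    refine Finset.sum_congr rfl fun i _ => ?_
    rw [hw i]
    ring
  have hw0 : w ≠ 0 := by
    rintro rfl
    apply hv0
    rw [hvw, smul_zero]
  refine ⟨w, c, hc1, fun x hx => le_trans ?_ (hv x hx)⟩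
  rw [hvw, value_smul, map_mul]
  exact le_mul_of_one_le_left (hQ.value_isTotPos hw0).norm_pos.le (one_le_norm_sq hg0)

/-- The value at `x` of the part of the Lagrange expansion with indices at least `i`. -/
def tailValue (h : Fin n → K) (U : Matrix (Fin n) (Fin n) K) (i : Fin n) (x : Fin n → 𝓞 K) : K :=
  ∑ l, if i ≤ l then h l * (∑ j, U l j * (x j : K)) ^ 2 else 0

omit [NumberField K] [IsTotallyReal K] in
theorem value_lagrange (h : Fin n → K) (U : Matrix (Fin n) (Fin n) K) (x : Fin n → 𝓞 K) :
    value (Uᵀ * Matrix.diagonal h * U) x = ∑ l, h l * (∑ j, U l j * (x j : K)) ^ 2 := by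
  rw [value_eq_dotProduct, dotProduct_congr_mulVec]
  rw [dotProduct]
  simp only [Matrix.mulVec_diagonal]
  simp only [Matrix.mulVec, dotProduct]
  refine Finset.sum_congr rfl fun l _ => ?_
  ring

/-- The outer coefficients are successive minima of the norm on the projected lattices. -/
def IsHKZ (h : Fin n → K) (U : Matrix (Fin n) (Fin n) K) : Prop :=
  ∀ (i : Fin n) (x : Fin n → 𝓞 K), (∃ j, i ≤ j ∧ x j ≠ 0) →
    Algebra.norm ℚ (h i) ≤ Algebra.norm ℚ (tailValue h U i x)

theorem exists_isHKZ [IsPrincipalIdealRing (𝓞 K)] : ∀ (n : ℕ) (Q : Matrix (Fin n) (Fin n) K),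
    IsTotPosForm Q → ∃ (T : Matrix (Fin n) (Fin n) (𝓞 K)) (h : Fin n → K)
      (U : Matrix (Fin n) (Fin n) K), IsUnit T ∧ IsUpperUnipotent U ∧
      (T.map (algebraMap (𝓞 K) K))ᵀ * Q * T.map (algebraMap (𝓞 K) K)
        = Uᵀ * Matrix.diagonal h * U ∧
      (∀ i, IsTotPos (h i)) ∧ IsHKZ h U := by
  intro n
  induction n with
  | zero =>
    intro Q _
    exact ⟨1, 0, 1, isUnit_one, ⟨fun i => i.elim0, fun i => i.elim0⟩,
      by ext i; exact i.elim0, fun i => i.elim0, fun i => i.elim0⟩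
  | succ n ih =>
    intro Q hQ
    set φ := algebraMap (𝓞 K) K
    obtain ⟨v, c, hvc, hvmin⟩ := exists_primitive_minimal_vector n.succ_pos hQ
    obtain ⟨T₁, hT₁, hT₁v⟩ := exists_isUnit_matrix_with_column v c hvc
    have hT₁φ : IsUnit (T₁.map φ) := hT₁.map φ.mapMatrix
    set Q₁ := (T₁.map φ)ᵀ * Q * T₁.map φ with hQ₁
    have hQ₁pos : IsTotPosForm Q₁ := hQ.congr hT₁φ
    have hT₁e : T₁ *ᵥ Pi.single 0 1 = v := by
      ext1 i
      rw [Matrix.mulVec_single_one]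
      exact hT₁v i
    have hQ₁00 : Q₁ 0 0 = value Q v := by
      rw [← hT₁e, ← value_congr, ← hQ₁]
      simp [value, Pi.single_apply]
    have hv0 : v ≠ 0 := by
      rintro rfl
      simp at hvc
    have ha : IsTotPos (Q₁ 0 0) := hQ₁00 ▸ hQ.value_isTotPos hv0
    obtain ⟨w, P, hPs, hQP⟩ := eq_rowShear_transpose_mul Q₁ hQ₁pos.1 ha.ne_zero
    set a := Q₁ 0 0 with hadef
    have hPpos : IsTotPosForm P := by
      refine ⟨hPs, fun y hy => ?_⟩
      -- The first coordinate is chosen to kill the first square, so `Q₁` takes the value `P(y)`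
      -- here.
      have hx : (Fin.cons (-(w ⬝ᵥ y)) y : Fin (n + 1) → K) ≠ 0 := by
        intro h0
        apply hy
        ext1 i
        have := congrFun h0 i.succ
        simpa using this
      have h1 := hQ₁pos.2 _ hx
      rw [hQP, dotProduct_congr_mulVec] at h1
      have h2 : rowShear w *ᵥ (Fin.cons (-(w ⬝ᵥ y)) y : Fin (n + 1) → K) = Fin.cons 0 y := by
        ext i
        refine Fin.cases ?_ (fun i => ?_) i
        · simp [Matrix.mulVec, dotProduct, Fin.sum_univ_succ]
        · simp [Matrix.mulVec, dotProduct, Fin.sum_univ_succ, Matrix.one_apply]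
      rw [h2] at h1
      have h3 : (Fin.cons 0 y : Fin (n + 1) → K) ⬝ᵥ
          diagBlock a P *ᵥ (Fin.cons 0 y : Fin (n + 1) → K) = y ⬝ᵥ P *ᵥ y := by
        simp [Matrix.mulVec, dotProduct, Fin.sum_univ_succ]
      rwa [h3] at h1
    obtain ⟨T₂, h₂, U₂, hT₂, hU₂, hPU, hh₂, hkz⟩ := ih P hPpos
    set r := w ᵥ* T₂.map φ with hr
    have hTmap : (T₁ * diagBlock 1 T₂).map φ = T₁.map φ * diagBlock 1 (T₂.map φ) := by
      rw [Matrix.map_mul, diagBlock_map]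
    have heq : ((T₁ * diagBlock 1 T₂).map φ)ᵀ * Q * (T₁ * diagBlock 1 T₂).map φ
        = (diagBlock 1 U₂ * rowShear r)ᵀ * Matrix.diagonal (Fin.cons a h₂ : Fin (n + 1) → K) *
          (diagBlock 1 U₂ * rowShear r) := by
      calc _ = (diagBlock 1 (T₂.map φ))ᵀ * Q₁ * diagBlock 1 (T₂.map φ) := by
            rw [hTmap, Matrix.transpose_mul, hQ₁]
            simp only [mul_assoc]
        _ = (rowShear w * diagBlock 1 (T₂.map φ))ᵀ * diagBlock a P *
            (rowShear w * diagBlock 1 (T₂.map φ)) := by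
            rw [hQP, Matrix.transpose_mul]
            simp only [mul_assoc]
        _ = (rowShear r)ᵀ * ((diagBlock 1 (T₂.map φ))ᵀ * diagBlock a P *
            diagBlock 1 (T₂.map φ)) * rowShear r := by
            rw [rowShear_mul_diagBlock, Matrix.transpose_mul]
            simp only [mul_assoc]
            rfl
        _ = (rowShear r)ᵀ * ((diagBlock 1 U₂)ᵀ * diagBlock a (Matrix.diagonal h₂) *
            diagBlock 1 U₂) * rowShear r := by
            simp only [diagBlock_transpose, diagBlock_mul, one_mul, mul_one, hPU]
        _ = _ := by
            rw [diagBlock_diagonal, Matrix.transpose_mul]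
            simp only [mul_assoc]
    have hTunit : IsUnit (T₁ * diagBlock 1 T₂) := hT₁.mul (isUnit_diagBlock hT₂)
    have hUsucc : ∀ i j : Fin n, (diagBlock 1 U₂ * rowShear r) i.succ j.succ = U₂ i j := by
      intro i j
      simp [Matrix.mul_apply, Fin.sum_univ_succ, Matrix.one_apply]
    have hUsucc0 : ∀ i : Fin n, (diagBlock 1 U₂ * rowShear r) i.succ 0 = 0 := by
      intro i
      simp [Matrix.mul_apply, Fin.sum_univ_succ]
    have hU00 : (diagBlock 1 U₂ * rowShear r) 0 0 = 1 := by
      simp [Matrix.mul_apply, Fin.sum_univ_succ]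
    refine ⟨T₁ * diagBlock 1 T₂, Fin.cons a h₂, diagBlock 1 U₂ * rowShear r, hTunit,
      ⟨?_, ?_⟩, heq, ?_, ?_⟩
    · intro i
      refine Fin.cases hU00 (fun i => ?_) i
      rw [hUsucc]
      exact hU₂.1 i
    · intro i j
      refine Fin.cases (fun h => absurd h (Fin.not_lt_zero _)) (fun i => ?_) i
      refine Fin.cases (fun _ => hUsucc0 i) (fun j h => ?_) j
      rw [hUsucc]
      exact hU₂.2 i j (Fin.succ_lt_succ_iff.mp h)
    · intro i
      exact Fin.cases ha hh₂ i
    · intro i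
      refine Fin.cases ?_ (fun i => ?_) i
      · rintro x ⟨j, -, hj⟩
        have hx : x ≠ 0 := fun h0 => hj (congrFun h0 j)
        have e : tailValue (Fin.cons a h₂) (diagBlock 1 U₂ * rowShear r) 0 x
            = value Q ((T₁ * diagBlock 1 T₂) *ᵥ x) := by
          rw [← value_congr, heq, value_lagrange]
          simp [tailValue]
        rw [e, Fin.cons_zero, hQ₁00]
        refine hvmin _ fun h0 => hx ?_
        exact Matrix.mulVec_injective_of_isUnit hTunit (by rw [h0, Matrix.mulVec_zero])
      · rintro x ⟨j, hij, hj⟩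
        -- Rows after the first do not involve `x 0`, so the tail is one of the smaller form.
        have e : tailValue (Fin.cons a h₂) (diagBlock 1 U₂ * rowShear r) i.succ x
            = tailValue h₂ U₂ i fun j => x j.succ := by
          unfold tailValue
          rw [Fin.sum_univ_succ, if_neg (by simp), zero_add]
          refine Finset.sum_congr rfl fun l _ => ?_
          simp only [Fin.succ_le_succ_iff, Fin.cons_succ, Fin.sum_univ_succ, hUsucc, hUsucc0,
            zero_mul, zero_add]
        rw [e, Fin.cons_succ]
        refine hkz i _ ?_
        obtain ⟨j', rfl⟩ : ∃ j', j = Fin.succ j' :=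
          Fin.exists_succ_eq.mpr (fun h0 => by rw [h0] at hij; simp at hij) |>.imp
            fun _ h => h.symm
        exact ⟨j', Fin.succ_le_succ_iff.mp hij, hj⟩

end HKZ

/-! ### Comparison of the norms of the outer coefficients. -/

section Growth

/-- The bound of Lagarias, Lenstra and Schnorr for sequences of successive minima. -/
theorem le_prod_rpow_of_pow_le (σ b : ℕ → ℝ) (hσ : ∀ k, 0 < σ k) (hb : ∀ s, 0 < b s) (m : ℕ)
    (h : ∀ s ≤ m, b s ^ (s + 1) ≤ σ (s + 1) ^ (s + 1) * ∏ q ∈ Finset.range (s + 1), b q) :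
    b m ≤ σ (m + 1) * (∏ k ∈ Finset.Icc 2 (m + 1), σ k ^ (1 / ((k : ℝ) - 1))) * b 0 := by
  set P : ℕ → ℝ := fun s => ∏ q ∈ Finset.range (s + 1), b q with hP
  have hPpos : ∀ s, 0 < P s := fun s => Finset.prod_pos fun q _ => hb q
  -- Induction on the geometric mean of `b 0, …, b s`: cancelling one `b (s + 1)` in the hypothesis
  -- bounds `P (s + 1) ^ (s + 1)` by `(σ (s + 2) * P s) ^ (s + 2)`, and a root of order `(s + 1) (s
  -- + 2)` follows.
  have key : ∀ s ≤ m, P s ^ (((s + 1 : ℕ) : ℝ)⁻¹) ≤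
      (∏ k ∈ Finset.Icc 2 (s + 1), σ k ^ (1 / ((k : ℝ) - 1))) * b 0 := by
    intro s
    induction s with
    | zero =>
      intro _
      simp [hP]
    | succ s ih =>
      intro hs
      have h1 := h (s + 1) hs
      have hPs : P (s + 1) = P s * b (s + 1) := Finset.prod_range_succ _ _
      have hbs := hb (s + 1)
      have hσs := hσ (s + 2)
      have hPp := hPpos s
      have hPp' := hPpos (s + 1)
      have h2 : b (s + 1) ^ (s + 1) ≤ σ (s + 2) ^ (s + 2) * P s := by
        refine le_of_mul_le_mul_right ?_ hbs
        calc _ = b (s + 1) ^ (s + 1 + 1) := (pow_succ _ _).symm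
          _ ≤ _ := h1
          _ = σ (s + 2) ^ (s + 2) * P (s + 1) := rfl
          _ = _ := by rw [hPs]; ring
      have h3 : P (s + 1) ^ (s + 1) ≤ (σ (s + 2) * P s) ^ (s + 2) := by
        rw [hPs, mul_pow, mul_pow]
        calc P s ^ (s + 1) * b (s + 1) ^ (s + 1)
            ≤ P s ^ (s + 1) * (σ (s + 2) ^ (s + 2) * P s) := by gcongr
          _ = _ := by ring
      have h4 : P (s + 1) ^ (((s + 1 + 1 : ℕ) : ℝ)⁻¹)
          ≤ (σ (s + 2) * P s) ^ (((s + 1 : ℕ) : ℝ)⁻¹) := by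
        have h5 := Real.rpow_le_rpow (by positivity) h3
          (z := ((s + 1 : ℕ) : ℝ)⁻¹ * ((s + 1 + 1 : ℕ) : ℝ)⁻¹) (by positivity)
        rw [← Real.rpow_natCast (P (s + 1)), ← Real.rpow_natCast (σ (s + 2) * P s),
          ← Real.rpow_mul hPp'.le, ← Real.rpow_mul (by positivity)] at h5
        have e1 : ((s + 1 : ℕ) : ℝ) * (((s + 1 : ℕ) : ℝ)⁻¹ * ((s + 1 + 1 : ℕ) : ℝ)⁻¹)
            = ((s + 1 + 1 : ℕ) : ℝ)⁻¹ := by field_simp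
        have e2 : ((s + 2 : ℕ) : ℝ) * (((s + 1 : ℕ) : ℝ)⁻¹ * ((s + 1 + 1 : ℕ) : ℝ)⁻¹)
            = ((s + 1 : ℕ) : ℝ)⁻¹ := by field_simp
        rwa [e1, e2] at h5
      rw [Real.mul_rpow hσs.le hPp.le] at h4
      refine h4.trans ?_
      rw [Finset.prod_Icc_succ_top (by omega)]
      have e3 : (1 : ℝ) / (((s + 1 + 1 : ℕ) : ℝ) - 1) = ((s + 1 : ℕ) : ℝ)⁻¹ := by
        push_cast
        rw [add_sub_cancel_right, one_div]
      rw [e3, mul_comm (∏ k ∈ Finset.Icc 2 (s + 1), σ k ^ (1 / ((k : ℝ) - 1))), mul_assoc]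
      exact mul_le_mul_of_nonneg_left (ih (by omega)) (by positivity)
  have hbm := hb m
  have hσm := hσ (m + 1)
  have h1 := Real.rpow_le_rpow (by positivity) (h m le_rfl)
    (z := ((m + 1 : ℕ) : ℝ)⁻¹) (by positivity)
  rw [Real.pow_rpow_inv_natCast hbm.le (by omega),
    Real.mul_rpow (by positivity) (hPpos m).le,
    Real.pow_rpow_inv_natCast hσm.le (by omega)] at h1
  rw [mul_assoc]
  exact h1.trans (mul_le_mul_of_nonneg_left (key m le_rfl) hσm.le)

variable {K : Type u} [Field K] [NumberField K] [IsTotallyReal K] {n : ℕ}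

/-- Minkowski's bound applied to the block of the expansion on `[i, j]`. Its short vector, extended
by zero, has no contribution from rows beyond `j` as `U` is triangular, so it competes with `h i` in
the minimality condition. -/
theorem IsHKZ.pow_le {h : Fin n → K} {U : Matrix (Fin n) (Fin n) K} (hkz : IsHKZ h U)
    (hh : ∀ i, IsTotPos (h i)) (hU : IsUpperUnipotent U) {i j : Fin n} (hij : i ≤ j) {k : ℕ}
    (hk : k = (Finset.Icc i j).card) :
    ((Algebra.norm ℚ (h i) : ℚ) : ℝ) ^ k ≤
      sigmaConst K k ^ k * ∏ l ∈ Finset.Icc i j, ((Algebra.norm ℚ (h l) : ℚ) : ℝ) := by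
  subst hk
  set s := Finset.Icc i j with hs
  have hne : Nonempty s := ⟨⟨i, Finset.mem_Icc.mpr ⟨le_rfl, hij⟩⟩⟩
  set d := Module.finrank ℚ K with hd
  have hd0 : d ≠ 0 := (Module.finrank_pos (R := ℚ) (M := K)).ne'
  have hcard : Fintype.card s = s.card := Fintype.card_coe s
  have hk0 : s.card ≠ 0 := by rw [← hcard]; exact Fintype.card_ne_zero
  set B : ℝ := sigmaConst K s.card ^ s.card *
    ∏ l ∈ s, ((Algebra.norm ℚ (h l) : ℚ) : ℝ) with hB
  have hB0 : 0 ≤ B := by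
    refine mul_nonneg (pow_nonneg (sigmaConst_pos K _).le _) (Finset.prod_nonneg fun l _ => ?_)
    exact (Rat.cast_pos.mpr (hh l).norm_pos).le
  set t : ℝ := (B ^ ((s.card : ℝ)⁻¹)) ^ ((d : ℝ)⁻¹) with ht
  have ht0 : 0 ≤ t := by positivity
  have htd : (t ^ d) ^ s.card = B := by
    rw [ht, Real.rpow_inv_natCast_pow (by positivity) hd0, Real.rpow_inv_natCast_pow hB0 hk0]
  set A : Matrix s s K := U.submatrix (↑) (↑) with hA
  have hAdet : A.det = 1 := by
    have hAtri : A.IsUpperTriangular := fun p q hpq => hU.2 _ _ hpq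
    rw [Matrix.det_of_isUpperTriangular hAtri]
    exact Finset.prod_eq_one fun p _ => hU.1 p
  obtain ⟨y, hy0, hyt⟩ := exists_diagValue_le (fun l : s => h l) (fun l => hh l) A hAdet t ht0 (by
    rw [← hd, hcard, htd, hB, Finset.prod_coe_sort s fun l => ((Algebra.norm ℚ (h l) : ℚ) : ℝ)])
  set x : Fin n → 𝓞 K := fun l => if hl : l ∈ s then y ⟨l, hl⟩ else 0 with hx
  have hxs : ∀ l : s, x l = y l := fun l => by simp [hx]
  have hx0 : ∀ l, l ∉ s → x l = 0 := fun l hl => by simp [hx, hl]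
  have hsum : ∀ l, ∑ q, U l q * (x q : K) = ∑ q : s, U l q * (y q : K) := by
    intro l
    rw [← Finset.sum_subset (Finset.subset_univ s)]
    · rw [← Finset.sum_coe_sort s]
      exact Finset.sum_congr rfl fun q _ => by rw [hxs]
    · intro q _ hq
      simp [hx0 q hq]
  have htail : tailValue h U i x = diagValue (fun l : s => h l) A y := by
    unfold tailValue diagValue
    rw [← Finset.sum_subset (Finset.subset_univ s), ← Finset.sum_coe_sort s]
    · refine Finset.sum_congr rfl fun l _ => ?_
      rw [if_pos (Finset.mem_Icc.mp l.2).1, hsum]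
      rfl
    · intro l _ hl
      split_ifs with hil
      · have hjl : j < l := by
          by_contra hc
          exact hl (Finset.mem_Icc.mpr ⟨hil, not_lt.mp hc⟩)
        rw [hsum, Finset.sum_eq_zero, zero_pow two_ne_zero, mul_zero]
        intro q _
        rw [hU.2 l q ((Finset.mem_Icc.mp q.2).2.trans_lt hjl), zero_mul]
      · rfl
  obtain ⟨q, hq⟩ := Function.ne_iff.mp hy0
  have h1 := hkz i x ⟨q, (Finset.mem_Icc.mp q.2).1, by rw [hxs]; exact hq⟩
  have h2 : ((Algebra.norm ℚ (h i) : ℚ) : ℝ) ≤ t ^ d := by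
    refine (Rat.cast_le.mpr h1).trans ?_
    rw [htail, norm_eq_prod_realEmbeddings]
    refine (Finset.prod_le_prod (fun ν _ => ?_) fun ν _ => hyt ν).trans ?_
    · unfold diagValue
      rw [map_sum]
      refine Finset.sum_nonneg fun l _ => ?_
      rw [map_mul, map_pow]
      exact mul_nonneg (hh l ν).le (sq_nonneg _)
    · rw [Finset.prod_const, Finset.card_univ, card_realEmbeddings]
  rw [← htd]
  exact pow_le_pow_left₀ (Rat.cast_pos.mpr (hh i).norm_pos).le h2 _

theorem IsHKZ.norm_le_alphaConst_mul {h : Fin n → K} {U : Matrix (Fin n) (Fin n) K}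
    (hkz : IsHKZ h U) (hh : ∀ i, IsTotPos (h i)) (hU : IsUpperUnipotent U) {i j : Fin n}
    (hij : i ≤ j) :
    ((Algebra.norm ℚ (h i) : ℚ) : ℝ) ≤
      alphaConst K ((j : ℕ) - i) * ((Algebra.norm ℚ (h j) : ℚ) : ℝ) := by
  -- Indices run backwards from `j`, so that the windows all end at `j`; only `s ≤ j - i` matters,
  -- where the subtraction is not truncated.
  set b : ℕ → ℝ := fun s => ((Algebra.norm ℚ (h ⟨(j : ℕ) - s, by omega⟩) : ℚ) : ℝ) with hb
  have hle := Fin.le_def.mp hij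
  have hprod : ∀ s ≤ (j : ℕ) - i, ∏ q ∈ Finset.range (s + 1), b q
      = ∏ l ∈ Finset.Icc (⟨(j : ℕ) - s, by omega⟩ : Fin n) j,
        ((Algebra.norm ℚ (h l) : ℚ) : ℝ) := by
    intro s hs
    refine Finset.prod_nbij' (fun q => (⟨(j : ℕ) - q, by omega⟩ : Fin n))
      (fun l => (j : ℕ) - l) ?_ ?_ ?_ ?_ ?_
    · intro q hq
      have := Finset.mem_range.mp hq
      rw [Finset.mem_Icc, Fin.le_def, Fin.le_def]
      simp only
      omega
    · intro l hl
      rw [Finset.mem_Icc, Fin.le_def, Fin.le_def] at hl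
      simp only at hl
      rw [Finset.mem_range]
      omega
    · intro q hq
      have := Finset.mem_range.mp hq
      simp only
      omega
    · intro l hl
      rw [Finset.mem_Icc, Fin.le_def, Fin.le_def] at hl
      simp only at hl
      apply Fin.ext
      simp only
      omega
    · intro q _
      rfl
  have h1 := le_prod_rpow_of_pow_le (sigmaConst K) b (sigmaConst_pos K)
    (fun s => Rat.cast_pos.mpr (hh _).norm_pos) ((j : ℕ) - i) (by
      intro s hs
      rw [hprod s hs]
      refine hkz.pow_le hh hU (Fin.le_def.mpr (by simp)) ?_
      rw [Fin.card_Icc]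
      simp only
      omega)
  have ei : b ((j : ℕ) - i) = ((Algebra.norm ℚ (h i) : ℚ) : ℝ) := by
    simp only [hb]
    congr 4
    omega
  have ej : b 0 = ((Algebra.norm ℚ (h j) : ℚ) : ℝ) := rfl
  rw [ei, ej] at h1
  exact h1

end Growth

/-! ### Balancing conjugates by units. -/

section UnitScaling

variable {K : Type u} [Field K] [NumberField K] [IsTotallyReal K]

/-- Replacing `y₀` by `y₀ e` cannot lower the trace. In the difference of traces only the `μ` term
can be positive, so it must outweigh the `ν` term; the remaining terms are nonpositive and are
dropped. -/
theorem IsTraceMinimizer.balanced {h y₀ : 𝓞 K} (hh : IsTotPos (h : K))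
    (hy : IsTraceMinimizer h y₀) (e : (𝓞 K)ˣ) {μ ν : K →+* ℝ}
    (hother : ∀ τ : K →+* ℝ, τ ≠ μ → |τ (e : 𝓞 K)| < 1) (hν : ν ≠ μ) :
    ν ((h : K) * (y₀ : K) ^ 2) ≤
      (|μ (e : 𝓞 K)| ^ 2 - 1) / (1 - |ν (e : 𝓞 K)| ^ 2) * μ ((h : K) * (y₀ : K) ^ 2) := by
  classical
  set g : K := (h : K) * (y₀ : K) ^ 2 with hg
  have hgpos : IsTotPos g := isTotPos_mul_sq hh hy.1
  have hlt : ∀ τ : K →+* ℝ, τ ≠ μ → |τ (e : 𝓞 K)| ^ 2 < 1 := fun τ hτ =>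
    pow_lt_one₀ (abs_nonneg _) (hother τ hτ) two_ne_zero
  have h1 := hy.2 (y₀ * e) (mul_ne_zero hy.1 e.ne_zero)
  have e1 : (h : K) * ((y₀ * e : 𝓞 K) : K) ^ 2 = g * ((e : 𝓞 K) : K) ^ 2 := by
    simp only [hg, map_mul]
    ring
  rw [e1] at h1
  have h2 : ∑ τ : K →+* ℝ, τ g ≤ ∑ τ : K →+* ℝ, τ (g * ((e : 𝓞 K) : K) ^ 2) := by
    rw [← trace_eq_sum_realEmbeddings, ← trace_eq_sum_realEmbeddings]
    exact_mod_cast h1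
  have h3 : 0 ≤ ∑ τ : K →+* ℝ, τ g * (|τ (e : 𝓞 K)| ^ 2 - 1) := by
    have : ∑ τ : K →+* ℝ, τ g * (|τ (e : 𝓞 K)| ^ 2 - 1)
        = ∑ τ : K →+* ℝ, τ (g * ((e : 𝓞 K) : K) ^ 2) - ∑ τ : K →+* ℝ, τ g := by
      rw [← Finset.sum_sub_distrib]
      refine Finset.sum_congr rfl fun τ _ => ?_
      rw [map_mul τ g, map_pow τ, sq_abs]
      ring
    rw [this]
    linarith
  rw [← Finset.add_sum_erase _ _ (Finset.mem_univ μ),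
    ← Finset.add_sum_erase _ _ (Finset.mem_erase.mpr ⟨hν, Finset.mem_univ ν⟩)] at h3
  have h4 : ∑ τ ∈ (Finset.univ.erase μ).erase ν, τ g * (|τ (e : 𝓞 K)| ^ 2 - 1) ≤ 0 := by
    refine Finset.sum_nonpos fun τ hτ => ?_
    have hτμ : τ ≠ μ := (Finset.mem_erase.mp (Finset.mem_erase.mp hτ).2).1
    exact mul_nonpos_of_nonneg_of_nonpos (hgpos τ).le (by linarith [hlt τ hτμ])
  have h5 : 0 < 1 - |ν (e : 𝓞 K)| ^ 2 := by linarith [hlt ν hν]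
  rw [div_mul_eq_mul_div, le_div_iff₀ h5]
  linarith

theorem exists_unit_balanced_integer {lam : ℝ} (hlam : IsReductionConstant K lam) {h : 𝓞 K}
    (hh : IsTotPos (h : K)) :
    ∃ e : (𝓞 K)ˣ, ∀ μ ν : K →+* ℝ,
      ν ((h : K) * ((e : 𝓞 K) : K) ^ 2) ≤ lam * μ ((h : K) * ((e : 𝓞 K) : K) ^ 2) := by
  obtain ⟨ε, Y, C, R, hε, hC, hY0, hY, hR, rfl⟩ := hlam
  obtain ⟨y₀, hy₀, y, hyY, w, hw⟩ := hY h hh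
  have hy0 := hY0 y hyY
  have hC1 : 1 ≤ C := hC.2 (Set.mem_insert _ _)
  set g : K := (h : K) * (y₀ : K) ^ 2 with hg
  have hgpos : IsTotPos g := isTotPos_mul_sq hh hy₀.1
  have hgC : ∀ μ ν : K →+* ℝ, ν g ≤ C * μ g := by
    intro μ ν
    by_cases hνμ : ν = μ
    · rw [hνμ]
      exact le_mul_of_one_le_left (hgpos μ).le hC1
    · refine (hy₀.balanced hh (ε μ) (fun τ hτ => (hε μ τ hτ).2) hνμ).trans ?_
      exact mul_le_mul_of_nonneg_right
        (hC.2 (Set.mem_insert_of_mem _ ⟨μ, ν, hνμ, rfl⟩)) (hgpos μ).le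
  -- Since `y₀ = y w⁻¹`, the coefficient `h w⁻²` is `h y₀²` divided by `y²`, and `R²` accounts for
  -- that division.
  refine ⟨w⁻¹, fun μ ν => ?_⟩
  have hrel : ∀ τ : K →+* ℝ, τ ((h : K) * (((w⁻¹ : (𝓞 K)ˣ) : 𝓞 K) : K) ^ 2) * τ (y : K) ^ 2
      = τ g := by
    intro τ
    rw [← map_pow τ, ← map_mul τ]
    congr 1
    have : (y : K) = (y₀ : K) * ((w : 𝓞 K) : K) := by
      simp only [← hw, map_mul]
    have hww : (((w⁻¹ : (𝓞 K)ˣ) : 𝓞 K) : K) * ((w : 𝓞 K) : K) = 1 := by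
      rw [← map_mul (algebraMap (𝓞 K) K), Units.inv_mul, map_one]
    rw [hg, this]
    calc _ = (h : K) * (y₀ : K) ^ 2 *
          ((((w⁻¹ : (𝓞 K)ˣ) : 𝓞 K) : K) * ((w : 𝓞 K) : K)) ^ 2 := by ring
      _ = _ := by rw [hww, one_pow, mul_one]
  set f : K := (h : K) * (((w⁻¹ : (𝓞 K)ˣ) : 𝓞 K) : K) ^ 2 with hf
  have hfpos : IsTotPos f := isTotPos_mul_sq hh (w⁻¹).ne_zero
  have hyν : 0 < |ν (y : K)| := abs_pos.mpr (map_ne_zero_of_ne_zero ν hy0)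
  have hyμ : 0 < |μ (y : K)| := abs_pos.mpr (map_ne_zero_of_ne_zero μ hy0)
  have hRle : |μ (y : K)| ≤ R * |ν (y : K)| := by
    rw [← div_le_iff₀ hyν]
    exact hR.2 ⟨y, hyY, ν, μ, rfl⟩
  have h1 : ν f * |ν (y : K)| ^ 2 ≤ C * (μ f * |μ (y : K)| ^ 2) := by
    rw [sq_abs, sq_abs, hrel, hrel]
    exact hgC μ ν
  have h2 : |μ (y : K)| ^ 2 ≤ (R * |ν (y : K)|) ^ 2 := by gcongr
  have h3 : C * (μ f * |μ (y : K)| ^ 2) ≤ C * (μ f * (R * |ν (y : K)|) ^ 2) := by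
    have := (hfpos μ).le
    gcongr
  refine le_of_mul_le_mul_right (a := |ν (y : K)| ^ 2) ?_ (by positivity)
  calc _ ≤ _ := h1
    _ ≤ _ := h3
    _ = _ := by ring

theorem exists_unit_balanced {lam : ℝ} (hlam : IsReductionConstant K lam) {h : K}
    (hh : IsTotPos h) :
    ∃ e : (𝓞 K)ˣ, ∀ μ ν : K →+* ℝ,
      ν (h * ((e : 𝓞 K) : K) ^ 2) ≤ lam * μ (h * ((e : 𝓞 K) : K) ^ 2) := by
  obtain ⟨D, hD0, hD⟩ := exists_integral_multiples ℤ ℚ (L := K) {h}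
  have hint := hD h (Finset.mem_singleton_self h)
  -- The square of the denominator is used to keep total positivity; a rational factor does not
  -- affect the balance.
  have hint2 : IsIntegral ℤ (((D ^ 2 : ℤ) : K) * h) := by
    have := (isIntegral_algebraMap (R := ℤ) (A := K) (x := D)).mul hint
    have e : ((D ^ 2 : ℤ) : K) * h = algebraMap ℤ K D * (D • h) := by
      rw [zsmul_eq_mul, eq_intCast]
      push_cast
      ring
    rwa [e]
  have hDpos : (0 : ℝ) < (D : ℝ) ^ 2 := by
    have : (D : ℝ) ≠ 0 := by exact_mod_cast hD0
    positivity
  have hτ : ∀ (τ : K →+* ℝ) (a : K), τ (((D ^ 2 : ℤ) : K) * h * a) = (D : ℝ) ^ 2 * τ (h * a) := by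
    intro τ a
    rw [mul_assoc, map_mul, map_intCast]
    push_cast
    rfl
  obtain ⟨e, he⟩ := exists_unit_balanced_integer hlam (h := ⟨_, hint2⟩) (fun τ => by
    have h1 := hτ τ 1
    rw [mul_one, mul_one] at h1
    exact h1 ▸ mul_pos hDpos (hh τ))
  refine ⟨e, fun μ ν => ?_⟩
  have h1 : ν (((D ^ 2 : ℤ) : K) * h * ((e : 𝓞 K) : K) ^ 2)
      ≤ lam * μ (((D ^ 2 : ℤ) : K) * h * ((e : 𝓞 K) : K) ^ 2) := he μ ν
  rw [hτ, hτ] at h1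
  refine le_of_mul_le_mul_left (a := (D : ℝ) ^ 2) (h1.trans (le_of_eq ?_)) hDpos
  ring

end UnitScaling

/-! ### Combining the three changes of variables. -/

section Assembly

variable {K : Type u} [Field K] [NumberField K] [IsTotallyReal K] {n : ℕ}

omit [NumberField K] [IsTotallyReal K] in
theorem map_dotProduct_mulVec (ν : K →+* ℝ) (Q : Matrix (Fin n) (Fin n) K) (x : Fin n → K) :
    ν (x ⬝ᵥ Q *ᵥ x) = (fun i => ν (x i)) ⬝ᵥ (Q.map ν) *ᵥ fun i => ν (x i) := by
  simp [dotProduct, Matrix.mulVec]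

omit [NumberField K] [IsTotallyReal K] in
theorem IsPosDef.isTotPosForm {Q : Matrix (Fin n) (Fin n) K} (hQ : IsPosDef Q) :
    IsTotPosForm Q := by
  refine ⟨hQ.1, fun x hx ν => ?_⟩
  rw [map_dotProduct_mulVec]
  have hx' : (fun i => ν (x i)) ≠ 0 := by
    intro h0
    apply hx
    ext1 i
    have := congrFun h0 i
    simpa using this
  simpa using (hQ.2 ν).dotProduct_mulVec_pos hx'

omit [NumberField K] [IsTotallyReal K] in
theorem isPosDef_lagrange {h : Fin n → K} (hh : ∀ i, IsTotPos (h i))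
    {U : Matrix (Fin n) (Fin n) K} (hU : IsUnit U) : IsPosDef (Uᵀ * Matrix.diagonal h * U) := by
  refine ⟨?_, fun ν => ?_⟩
  · rw [Matrix.IsSymm, Matrix.transpose_mul, Matrix.transpose_mul, Matrix.transpose_transpose,
      Matrix.diagonal_transpose, mul_assoc]
  · have e : (Uᵀ * Matrix.diagonal h * U).map ν
        = (U.map ν)ᴴ * Matrix.diagonal (fun i => ν (h i)) * U.map ν := by
      rw [Matrix.map_mul, Matrix.map_mul, Matrix.diagonal_map (map_zero ν),
        Matrix.conjTranspose_eq_transpose_of_trivial, Matrix.transpose_map]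
    rw [e]
    refine Matrix.PosDef.conjTranspose_mul_mul_same (Matrix.PosDef.diagonal fun i => hh i ν) ?_
    exact Matrix.mulVec_injective_of_isUnit (hU.map ν.mapMatrix)

omit [NumberField K] [IsTotallyReal K] in
theorem VanishesBelow.isUpperUnipotent {U : Matrix (Fin n) (Fin n) K}
    (hU : VanishesBelow 1 (U - 1)) : IsUpperUnipotent U := by
  refine ⟨fun i => ?_, fun i j hij => ?_⟩
  · have := hU i i (by omega)
    rwa [Matrix.sub_apply, Matrix.one_apply_eq, sub_eq_zero] at this
  · have := hU i j (by have := Fin.lt_def.mp hij; omega)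
    rwa [Matrix.sub_apply, Matrix.one_apply_ne (ne_of_gt hij), sub_zero] at this

omit [NumberField K] [IsTotallyReal K] in
theorem IsUpperUnipotent.vanishesBelow {U : Matrix (Fin n) (Fin n) K}
    (hU : IsUpperUnipotent U) : VanishesBelow 1 (U - 1) := by
  intro i j hij
  rw [Matrix.sub_apply]
  rcases (Fin.le_def.mpr (by omega) : j ≤ i).lt_or_eq with h | h
  · rw [hU.2 i j h, Matrix.one_apply_ne (ne_of_gt h), sub_zero]
  · rw [h, hU.1, Matrix.one_apply_eq, sub_self]

omit [NumberField K] [IsTotallyReal K] in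
/-- Scaling the variables by `c` scales the outer coefficients by `c²`. -/
theorem lagrange_scale {U : Matrix (Fin n) (Fin n) K} (hU : IsUpperUnipotent U) (h : Fin n → K)
    {c : Fin n → K} (hc : ∀ i, c i ≠ 0) :
    ∃ V : Matrix (Fin n) (Fin n) K, IsUpperUnipotent V ∧
      (Matrix.diagonal c)ᵀ * (Uᵀ * Matrix.diagonal h * U) * Matrix.diagonal c
        = Vᵀ * Matrix.diagonal (fun i => h i * c i ^ 2) * V := by
  set V : Matrix (Fin n) (Fin n) K := Matrix.of fun i j => (c i)⁻¹ * U i j * c j with hV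
  have hUV : U * Matrix.diagonal c = Matrix.diagonal c * V := by
    ext i j
    rw [Matrix.mul_diagonal, Matrix.diagonal_mul, hV, Matrix.of_apply, mul_assoc,
      mul_inv_cancel_left₀ (hc i)]
  have hdd : (Matrix.diagonal c)ᵀ * Matrix.diagonal h * Matrix.diagonal c
      = Matrix.diagonal fun i => h i * c i ^ 2 := by
    rw [Matrix.diagonal_transpose, Matrix.diagonal_mul_diagonal, Matrix.diagonal_mul_diagonal]
    congr 1
    ext i
    ring
  refine ⟨V, ⟨fun i => ?_, fun i j hij => ?_⟩, ?_⟩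
  · rw [hV, Matrix.of_apply, hU.1, mul_one, inv_mul_cancel₀ (hc i)]
  · rw [hV, Matrix.of_apply, hU.2 i j hij, mul_zero, zero_mul]
  · calc _ = (U * Matrix.diagonal c)ᵀ * Matrix.diagonal h * (U * Matrix.diagonal c) := by
          rw [Matrix.transpose_mul]
          simp only [mul_assoc]
      _ = Vᵀ * ((Matrix.diagonal c)ᵀ * Matrix.diagonal h * Matrix.diagonal c) * V := by
          rw [hUV, Matrix.transpose_mul]
          simp only [mul_assoc]
      _ = _ := by rw [hdd]

theorem exists_balanced_hkz [IsPrincipalIdealRing (𝓞 K)] {D₁ lam : ℝ}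
    (hD₁ : IsGrowthConstant K D₁) (hlam : IsReductionConstant K lam)
    {Q : Matrix (Fin n) (Fin n) K} (hQ : IsPosDef Q) :
    ∃ Q' : Matrix (Fin n) (Fin n) K, IntegrallyEquivalent Q Q' ∧
      IsBalancedHKZReduced D₁ lam Q' := by
  obtain ⟨T, h, U, hT, hU, hQU, hh, hkz⟩ := exists_isHKZ n Q hQ.isTotPosForm
  choose e he using fun i => exists_unit_balanced hlam (hh i)
  set c : Fin n → K := fun i => ((e i : 𝓞 K) : K) with hc
  have hc0 : ∀ i, c i ≠ 0 := fun i => by simp [hc]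
  obtain ⟨V, hV, hUV⟩ := lagrange_scale hU h hc0
  set g : Fin n → K := fun i => h i * c i ^ 2 with hg
  have hgpos : ∀ i, IsTotPos (g i) := fun i => (hh i).mul (isTotPos_sq (hc0 i))
  have hgnorm : ∀ i, Algebra.norm ℚ (g i) = Algebra.norm ℚ (h i) := by
    intro i
    rw [hg]
    simp only [map_mul]
    rw [norm_unit_sq, mul_one]
  obtain ⟨S, N, hS, hN, hNβ, hVS⟩ := exists_mul_eq_exp V hV.vanishesBelow
  set φ := algebraMap (𝓞 K) K with hφ
  have hNneg : VanishesBelow 1 (-N) := hN.neg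
  set W := IsNilpotent.exp N with hW
  set W' := IsNilpotent.exp (-N) with hW'
  have hWW' : W * W' = 1 := IsNilpotent.exp_mul_exp_neg_self hN.isNilpotent
  have hWuni : IsUpperUnipotent W := (exp_sub_one_vanishesBelow hN).isUpperUnipotent
  have hWunit : IsUnit W := IsNilpotent.isUnit_exp hN.isNilpotent
  set Dg : Matrix (Fin n) (Fin n) (𝓞 K) := Matrix.diagonal fun i => (e i : 𝓞 K) with hDg
  have hDgφ : Dg.map φ = Matrix.diagonal c := Matrix.diagonal_map (map_zero φ)
  have hDgunit : IsUnit Dg := by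
    rw [Matrix.isUnit_iff_isUnit_det, hDg, Matrix.det_diagonal]
    exact IsUnit.prod_univ_iff.mpr fun i => (e i).isUnit
  have hSunit : IsUnit S := by
    rw [Matrix.isUnit_iff_isUnit_det, hS.det_eq_one]
    exact isUnit_one
  -- `T` makes the outer coefficients minimal, `Dg` balances their conjugates, and `S` makes the
  -- unipotent factor an exponential without changing them.
  have hunit : IsUnit (T * Dg * S) := (hT.mul hDgunit).mul hSunit
  have hcongr : ((T * Dg * S).map φ)ᵀ * Q * (T * Dg * S).map φ
      = ((Dg * S).map φ)ᵀ * (Uᵀ * Matrix.diagonal h * U) * (Dg * S).map φ := by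
    rw [← hQU, mul_assoc T, Matrix.map_mul, Matrix.transpose_mul]
    simp only [mul_assoc]
  have hlag : ((T * Dg * S).map φ)ᵀ * Q * (T * Dg * S).map φ = Wᵀ * Matrix.diagonal g * W := by
    calc _ = (S.map φ)ᵀ * ((Matrix.diagonal c)ᵀ * (Uᵀ * Matrix.diagonal h * U) *
          Matrix.diagonal c) * S.map φ := by
          rw [hcongr, Matrix.map_mul, hDgφ, Matrix.transpose_mul]
          simp only [mul_assoc]
      _ = _ := by
          rw [hUV, ← hVS, Matrix.transpose_mul]
          simp only [mul_assoc]
  refine ⟨((T * Dg * S).map φ)ᵀ * Q * (T * Dg * S).map φ, ⟨hunit.unit, rfl⟩,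
    ⟨?_, g, W, ⟨hWuni, hlag⟩, ?_, ?_, fun i μ ν => he i μ ν⟩,
    ⟨g, W, ⟨hWuni, hlag⟩, inE_exp hN hNβ⟩,
    ⟨fun i => (g i)⁻¹, W', ⟨(exp_sub_one_vanishesBelow hNneg).isUpperUnipotent, ?_⟩,
      inE_exp hNneg fun i j ν => ?_⟩⟩
  · rw [hlag]
    exact isPosDef_lagrange hgpos hWunit
  · intro i hi
    have hi0 : ∀ l : Fin n, i ≤ l := fun l => Fin.le_def.mpr (by omega)
    -- The first basis vector attains the outer coefficient of index 0. For the lower bound, values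
    -- are carried back through `Dg * S` to the expansion given by `exists_isHKZ`, whose tail at
    -- index 0 is the whole form.
    refine ⟨⟨Pi.single i 1, ?_, ?_⟩, ?_⟩
    · intro h0
      have := congrFun h0 i
      simp at this
    · rw [hlag, value_lagrange]
      congr 1
      rw [Finset.sum_eq_single i]
      · simp [Pi.single_apply, apply_ite, hWuni.1]
      · intro l _ hl
        have hWl : W l i = 0 := hWuni.2 l i (lt_of_le_of_ne (hi0 l) hl.symm)
        simp [Pi.single_apply, apply_ite, hWl]
      · intro h0
        exact absurd (Finset.mem_univ i) h0
    · rintro r ⟨x, hx, rfl⟩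
      rw [hcongr, value_congr, hgnorm]
      have hx' : (Dg * S) *ᵥ x ≠ 0 := by
        intro h0
        apply hx
        exact Matrix.mulVec_injective_of_isUnit (hDgunit.mul hSunit)
          (by rw [h0, Matrix.mulVec_zero])
      obtain ⟨j, hj⟩ := Function.ne_iff.mp hx'
      have h1 := hkz i _ ⟨j, hi0 j, hj⟩
      rw [value_lagrange]
      simpa only [tailValue, if_pos (hi0 _)] using h1
  · intro i j hij
    rw [hgnorm, hgnorm]
    have hm : 1 ≤ (j : ℕ) - i := by have := Fin.lt_def.mp hij; omega
    refine (hkz.norm_le_alphaConst_mul hh hU hij.le).trans ?_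
    exact mul_le_mul_of_nonneg_right (hD₁ _ hm).1 (Rat.cast_pos.mpr (hh j).norm_pos).le
  · refine Matrix.inv_eq_right_inv ?_
    have hdd : Matrix.diagonal g * Matrix.diagonal (fun i => (g i)⁻¹) = 1 := by
      rw [Matrix.diagonal_mul_diagonal, ← Matrix.diagonal_one]
      congr 1
      ext i
      exact mul_inv_cancel₀ (hgpos i).ne_zero
    have hW'W : Wᵀ * W'ᵀ = 1 := by
      rw [← Matrix.transpose_mul, IsNilpotent.exp_neg_mul_exp_self hN.isNilpotent,
        Matrix.transpose_one]
    rw [hlag]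
    calc _ = Wᵀ * (Matrix.diagonal g * ((W * W') * Matrix.diagonal (fun i => (g i)⁻¹))) *
          W'ᵀ := by simp only [mul_assoc]
      _ = 1 := by rw [hWW', one_mul, hdd, mul_one, hW'W]
  · rw [Matrix.neg_apply, map_neg, abs_neg]
    exact hNβ i j ν

end Assembly

end HumbertReduction
end

theorem proposition3p13 :
    (∀ d : ℕ, 0 < d → ∃ D₁ : ℝ,
      ∀ (K : Type u) [Field K] [NumberField K] [NumberField.IsTotallyReal K],
        Module.finrank ℚ K = d → HumbertReduction.IsGrowthConstant K D₁) ∧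
    ∀ (K : Type u) [Field K] [NumberField K] [NumberField.IsTotallyReal K],
      (∃ lam : ℝ, HumbertReduction.IsReductionConstant K lam) ∧
      ∀ D₁ lam : ℝ, HumbertReduction.IsGrowthConstant K D₁ →
        HumbertReduction.IsReductionConstant K lam →
        NumberField.classNumber K = 1 →
        ∀ (n : ℕ) (Q : Matrix (Fin n) (Fin n) K), HumbertReduction.IsPosDef Q →
          ∃ Q' : Matrix (Fin n) (Fin n) K,
            HumbertReduction.IntegrallyEquivalent Q Q' ∧
            HumbertReduction.IsBalancedHKZReduced D₁ lam Q' := by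
  refine ⟨fun d _ => ⟨Real.exp (d * 14), fun K _ _ _ hK => ?_⟩, fun K _ _ _ =>
    ⟨HumbertReduction.exists_isReductionConstant K, fun D₁ lam hD₁ hlam hcl n Q hQ => ?_⟩⟩
  · rw [← hK]
    exact HumbertReduction.isGrowthConstant_exp K
  · have : IsPrincipalIdealRing (𝓞 K) := NumberField.classNumber_eq_one_iff.mp hcl
    exact HumbertReduction.exists_balanced_hkz hD₁ hlam hQ
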